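/- Let $M$ be a smooth (Hausdorff, second countable) manifold of dimension $2n+1$ with a paracontact metric structure $(\varphi,\xi,\eta,g)$. That is: $\varphi$ is a smooth $(1,1)$-tensor field, $\xi$ a smooth vector field, $\eta$ a smooth $1$-form and $g$ a smooth pseudo-Riemannian metric such that $$\varphi\xi=0,\quad \eta\circ\varphi=0,\quad \eta(\xi)=1,\quad \varphi^2=\mathrm{id}-\eta\otimes\xi,$$ the eigenspaces of $\varphi$ on $\mathbb D=\ker\eta$ for the eigenvalues $+1$ and $-1$ both have dimension $n$ at every point, and $$g(\varphi X,\varphi Y)=-g(X,Y)+\eta(X)\eta(Y),\qquad g(X,\varphi Y)=d\eta(X,Y)=\tfrac12\bigl(X\eta(Y)-Y\eta(X)-\eta([X,Y])\bigr).$$ Let $\nabla$ be the Levi-Civita connection of $g$, $R(X,Y)Z=\nabla_X\nabla_YZ-\nabla_Y\nabla_XZ-\nabla_{[X,Y]}Z$ its curvature, $h=\frac12\mathcal L_\xi\varphi$, and let $[+1]$ and $[-1]$ denote the eigenspaces of $h$ for the eigenvalues $+1$ and $-1$. Suppose that the sectional curvature of every nondegenerate tangent plane containing $\xi$ vanishes.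 Then: 1. At every point $h$ has rank $2n$, and $\mathbb D=[+1]\oplus[-1]$. 2. If moreover $R(X,Y)\xi=0$ for all $X,Y\in[+1]$, then $M$ admits a smooth foliation by $n$-dimensional integral submanifolds of $\mathbb D$ (every vector tangent to a leaf lies in $\mathbb D$) along which $\xi$ is parallel ($\nabla_v\xi=0$ for every vector $v$ tangent to a leaf). -/

import Mathlib

open scoped Manifold ContDiff Bundle Topology

/-! ### Pseudo-Riemannian metrics and their Levi-Civita connection -/

/-- A smooth pseudo-Riemannian metric on `M`: a smooth field of symmetric nondegenerate bilinear
forms on the tangent spaces. -/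
structure PseudoRiemannianMetric {E : Type*} [NormedAddCommGroup E] [NormedSpace ℝ E]
    {H : Type*} [TopologicalSpace H] (I : ModelWithCorners ℝ E H)
    (M : Type*) [TopologicalSpace M] [ChartedSpace H M] [IsManifold I ∞ M] where
  val (p : M) : TangentSpace I p →L[ℝ] TangentSpace I p →L[ℝ] ℝ
  symm (p : M) (u v : TangentSpace I p) : val p u v = val p v u
  nondegenerate (p : M) (u : TangentSpace I p) (hu : ∀ v, val p u v = 0) : u = 0
  smooth : ContMDiff I (I.prod 𝓘(ℝ, E →L[ℝ] E →L[ℝ] ℝ)) ∞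
    (fun p ↦ Bundle.TotalSpace.mk' (E →L[ℝ] E →L[ℝ] ℝ) p (val p))

section Geometry

open VectorField FiberBundle

variable {E : Type*} [NormedAddCommGroup E] [NormedSpace ℝ E] [FiniteDimensional ℝ E]
  [CompleteSpace E] {H : Type*} [TopologicalSpace H] {I : ModelWithCorners ℝ E H}
  {M : Type*} [TopologicalSpace M] [ChartedSpace H M] [IsManifold I ∞ M]

namespace PseudoRiemannianMetric

variable (g : PseudoRiemannianMetric I M)
  {X X' Y Y' Z Z' : Π p : M, TangentSpace I p} {f : M → ℝ} {p : M}

/-- The right-hand side of the Koszul formula: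
`X g(Y,Z) + Y g(X,Z) - Z g(X,Y) + g([X,Y],Z) - g([X,Z],Y) - g([Y,Z],X)`. -/
noncomputable def koszul (X Y Z : Π p : M, TangentSpace I p) (p : M) : ℝ :=
  d% (fun q ↦ g.val q (Y q) (Z q)) p (X p) + d% (fun q ↦ g.val q (X q) (Z q)) p (Y p)
    - d% (fun q ↦ g.val q (X q) (Y q)) p (Z p)
    + g.val p (mlieBracket I X Y p) (Z p) - g.val p (mlieBracket I X Z p) (Y p)
    - g.val p (mlieBracket I Y Z p) (X p)

lemma mdifferentiableAt_apply (hX : MDiffAt (T% X) p) (hY : MDiffAt (T% Y) p) :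
    MDiffAt (fun q ↦ g.val q (X q) (Y q)) p := by
  have h := MDifferentiableAt.clm_bundle_apply₂ (F₁ := E) (F₂ := E) (E₃ := Bundle.Trivial M ℝ)
    (F₃ := ℝ) (g.smooth.mdifferentiableAt (by simp) (x := p)) hX hY
  exact ((mdifferentiableAt_totalSpace ..).1 h).2

lemma d_add_left (hX : MDiffAt (T% X) p) (hX' : MDiffAt (T% X') p) (hY : MDiffAt (T% Y) p) :
    d% (fun q ↦ g.val q ((X + X') q) (Y q)) p = d% (fun q ↦ g.val q (X q) (Y q)) p +
      d% (fun q ↦ g.val q (X' q) (Y q)) p := by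
  simp only [Pi.add_apply, map_add, add_apply]
  exact mvfderiv_fun_add (g.mdifferentiableAt_apply hX hY) (g.mdifferentiableAt_apply hX' hY)

lemma d_add_right (hX : MDiffAt (T% X) p) (hX' : MDiffAt (T% X') p) (hY : MDiffAt (T% Y) p) :
    d% (fun q ↦ g.val q (Y q) ((X + X') q)) p = d% (fun q ↦ g.val q (Y q) (X q)) p +
      d% (fun q ↦ g.val q (Y q) (X' q)) p := by
  simp only [Pi.add_apply, map_add]
  exact mvfderiv_fun_add (g.mdifferentiableAt_apply hY hX) (g.mdifferentiableAt_apply hY hX')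

lemma d_smul_left (hf : MDiffAt f p) (hX : MDiffAt (T% X) p) (hY : MDiffAt (T% Y) p) :
    d% (fun q ↦ g.val q ((f • X) q) (Y q)) p = f p • d% (fun q ↦ g.val q (X q) (Y q)) p +
      g.val p (X p) (Y p) • d% f p := by
  simp only [Pi.smul_apply', map_smul, smul_apply, smul_eq_mul]
  rw [mvfderiv_fun_mul hf (g.mdifferentiableAt_apply hX hY)]

lemma d_smul_right (hf : MDiffAt f p) (hX : MDiffAt (T% X) p) (hY : MDiffAt (T% Y) p) :
    d% (fun q ↦ g.val q (Y q) ((f • X) q)) p = f p • d% (fun q ↦ g.val q (Y q) (X q)) p +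
      g.val p (Y p) (X p) • d% f p := by
  simp only [Pi.smul_apply', map_smul, smul_eq_mul]
  rw [mvfderiv_fun_mul hf (g.mdifferentiableAt_apply hY hX)]

lemma tensorialAt_koszul_left (hY : MDiffAt (T% Y) p) (hZ : MDiffAt (T% Z) p) :
    TensorialAt I E (fun X ↦ g.koszul X Y Z p) p where
  smul {f X} hf hX := by
    simp only [koszul]
    rw [g.d_smul_left hf hX hZ, g.d_smul_left hf hX hY, mlieBracket_smul_left hf hX,
      mlieBracket_smul_left hf hX]
    simp
    ring
  add {X X'} hX hX' := by
    simp only [koszul]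
    rw [g.d_add_left hX hX' hZ, g.d_add_left hX hX' hY, mlieBracket_add_left hX hX',
      mlieBracket_add_left hX hX']
    simp
    ring

lemma tensorialAt_koszul_right (hX : MDiffAt (T% X) p) (hY : MDiffAt (T% Y) p) :
    TensorialAt I E (fun Z ↦ g.koszul X Y Z p) p where
  smul {f Z} hf hZ := by
    simp only [koszul]
    rw [g.d_smul_right hf hZ hX, g.d_smul_right hf hZ hY, mlieBracket_smul_right hf hZ,
      mlieBracket_smul_right hf hZ]
    simp
    rw [g.symm p (Z p) (X p), g.symm p (Z p) (Y p)]
    ring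
  add {Z Z'} hZ hZ' := by
    simp only [koszul]
    rw [g.d_add_right hZ hZ' hX, g.d_add_right hZ hZ' hY, mlieBracket_add_right hZ hZ',
      mlieBracket_add_right hZ hZ']
    simp
    ring

lemma koszul_smul_middle (hf : MDiffAt f p) (hX : MDiffAt (T% X) p) (hY : MDiffAt (T% Y) p)
    (hZ : MDiffAt (T% Z) p) :
    g.koszul X (f • Y) Z p = f p * g.koszul X Y Z p + 2 * (d% f p (X p) * g.val p (Y p) (Z p)) := by
  simp only [koszul]
  rw [g.d_smul_left hf hY hZ, g.d_smul_right hf hY hX, mlieBracket_smul_right hf hY,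
    mlieBracket_smul_left hf hY]
  simp
  rw [g.symm p (Y p) (X p)]
  ring

lemma koszul_add_middle (hX : MDiffAt (T% X) p) (hY : MDiffAt (T% Y) p)
    (hY' : MDiffAt (T% Y') p) (hZ : MDiffAt (T% Z) p) :
    g.koszul X (Y + Y') Z p = g.koszul X Y Z p + g.koszul X Y' Z p := by
  simp only [koszul]
  rw [g.d_add_left hY hY' hZ, g.d_add_right hY hY' hX, mlieBracket_add_right hY hY',
    mlieBracket_add_left hY hY']
  simp
  ring

lemma flat_bijective (p : M) : Function.Bijective (g.val p) := by
  have : FiniteDimensional ℝ (TangentSpace I p) := inferInstanceAs (FiniteDimensional ℝ E)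
  have : T2Space (TangentSpace I p) := inferInstanceAs (T2Space E)
  have hinj : Function.Injective (g.val p).toLinearMap :=
    (injective_iff_map_eq_zero _).2 fun u hu ↦ g.nondegenerate p u fun v ↦ congr($hu v)
  have hdim : Module.finrank ℝ (TangentSpace I p) =
      Module.finrank ℝ (TangentSpace I p →L[ℝ] ℝ) := by
    rw [← (LinearMap.toContinuousLinearMap (𝕜 := ℝ) (E := TangentSpace I p)
      (F' := ℝ)).finrank_eq]
    exact Subspace.dual_finrank_eq.symm
  exact ⟨hinj, (LinearMap.injective_iff_surjective_of_finrank_eq_finrank hdim).1 hinj⟩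

/-- The musical isomorphism `u ↦ g(u, ·)`. -/
noncomputable def flat (p : M) : TangentSpace I p ≃ₗ[ℝ] (TangentSpace I p →L[ℝ] ℝ) :=
  LinearEquiv.ofBijective (g.val p).toLinearMap (g.flat_bijective p)

open Classical in
/-- `leviCivitaFun g Y p v` is `∇_v Y` at `p`, the vector determined by the Koszul formula
`2 g(∇_X Y, Z) = koszul X Y Z` (and `0` by convention where `Y` is not differentiable). -/
noncomputable def leviCivitaFun (Y : Π p : M, TangentSpace I p) (p : M) :
    TangentSpace I p →L[ℝ] TangentSpace I p :=
  have : FiniteDimensional ℝ (TangentSpace I p) := inferInstanceAs (FiniteDimensional ℝ E)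
  have : T2Space (TangentSpace I p) := inferInstanceAs (T2Space E)
  if hY : MDiffAt (T% Y) p then
    (1 / 2 : ℝ) • LinearMap.toContinuousLinearMap ((g.flat p).symm.toLinearMap ∘ₗ
      (TensorialAt.mkHom₂ (fun X Z ↦ g.koszul X Y Z p) p
        (fun _ hZ ↦ g.tensorialAt_koszul_left hY hZ)
        (fun _ hX ↦ g.tensorialAt_koszul_right hX hY)).toLinearMap)
  else 0

/-- The Koszul formula. -/
lemma leviCivitaFun_spec (hX : MDiffAt (T% X) p) (hY : MDiffAt (T% Y) p)
    (hZ : MDiffAt (T% Z) p) :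
    2 * g.val p (g.leviCivitaFun Y p (X p)) (Z p) = g.koszul X Y Z p := by
  have key (α : TangentSpace I p →L[ℝ] ℝ) : g.val p ((g.flat p).symm α) = α :=
    (g.flat p).apply_symm_apply α
  rw [leviCivitaFun, dif_pos hY]
  simp [key]
  exact TensorialAt.mkHom₂_apply (fun _ hZ ↦ g.tensorialAt_koszul_left hY hZ)
        (fun _ hX ↦ g.tensorialAt_koszul_right hX hY) hX hZ

lemma ext_of_apply {u v : TangentSpace I p} (h : ∀ w, g.val p u w = g.val p v w) : u = v :=
  sub_eq_zero.1 <| g.nondegenerate p _ fun w ↦ by simp [h w]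

/-- The Levi-Civita connection of `g`; `g.leviCivita Y p (X p)` is `(∇_X Y)(p)`. -/
noncomputable def leviCivita : CovariantDerivative I E (TangentSpace I : M → Type _) where
  toFun := g.leviCivitaFun
  isCovariantDerivativeOnUniv :=
    { add := fun {Y Y' p} hY hY' _ ↦ by
        ext v
        refine g.ext_of_apply fun w ↦ ?_
        have hV := mdifferentiableAt_extend I E (V := (TangentSpace I : M → Type _)) v
        have hW := mdifferentiableAt_extend I E (V := (TangentSpace I : M → Type _)) w
        have h1 := g.leviCivitaFun_spec hV (mdifferentiableAt_add_section hY hY') hW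
        have h2 := g.leviCivitaFun_spec hV hY hW
        have h3 := g.leviCivitaFun_spec hV hY' hW
        rw [g.koszul_add_middle hV hY hY' hW, ← h2, ← h3] at h1
        simp at h1 ⊢
        linarith
      leibniz := fun {Y f p} hY hf _ ↦ by
        ext v
        refine g.ext_of_apply fun w ↦ ?_
        have hV := mdifferentiableAt_extend I E (V := (TangentSpace I : M → Type _)) v
        have hW := mdifferentiableAt_extend I E (V := (TangentSpace I : M → Type _)) w
        have h1 := g.leviCivitaFun_spec hV (hf.smul_section hY) hW
        have h2 := g.leviCivitaFun_spec hV hY hW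
        have h4 := g.koszul_smul_middle hf hV hY hW
        rw [← h2] at h4
        have h5 := h1.trans h4
        simp at h5 ⊢
        linarith }

/-- The Levi-Civita connection is torsion-free. -/
lemma leviCivita_torsion_free (hX : MDiffAt (T% X) p) (hY : MDiffAt (T% Y) p) :
    g.leviCivita Y p (X p) - g.leviCivita X p (Y p) = mlieBracket I X Y p := by
  refine g.ext_of_apply fun w ↦ ?_
  have hW := mdifferentiableAt_extend I E (V := (TangentSpace I : M → Type _)) w
  have h1 := g.leviCivitaFun_spec hX hY hW
  have h2 := g.leviCivitaFun_spec hY hX hW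
  have h3 (q : M) : g.val q (Y q) (X q) = g.val q (X q) (Y q) := g.symm q _ _
  have h4 : g.val p (mlieBracket I Y X p) w = - g.val p (mlieBracket I X Y p) w := by
    rw [mlieBracket_swap_apply]; simp
  simp only [koszul, extend_apply_self, h3, h4] at h1 h2
  change g.val p (g.leviCivitaFun Y p (X p) - g.leviCivitaFun X p (Y p)) w = _
  simp
  linarith

/-- The Levi-Civita connection is metric. -/
lemma leviCivita_metric (hX : MDiffAt (T% X) p) (hY : MDiffAt (T% Y) p)
    (hZ : MDiffAt (T% Z) p) :
    d% (fun q ↦ g.val q (Y q) (Z q)) p (X p) =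
      g.val p (g.leviCivita Y p (X p)) (Z p) + g.val p (Y p) (g.leviCivita Z p (X p)) := by
  have h1 := g.leviCivitaFun_spec hX hY hZ
  have h2 := g.leviCivitaFun_spec hX hZ hY
  have h3 (q : M) : g.val q (Z q) (Y q) = g.val q (Y q) (Z q) := g.symm q _ _
  have h4 : g.val p (mlieBracket I Z Y p) (X p) = - g.val p (mlieBracket I Y Z p) (X p) := by
    rw [mlieBracket_swap_apply]; simp
  simp only [koszul, h3, h4] at h1 h2
  rw [g.symm p (Y p)]
  change _ = g.val p (g.leviCivitaFun Y p (X p)) (Z p) + g.val p (g.leviCivitaFun Z p (X p)) (Y p)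
  linarith

/-- `R(X,Y)Z = ∇_X ∇_Y Z - ∇_Y ∇_X Z - ∇_{[X,Y]} Z` on vector fields. -/
noncomputable def curvature (X Y Z : Π p : M, TangentSpace I p) (p : M) : TangentSpace I p :=
  g.leviCivita (fun q ↦ g.leviCivita Z q (Y q)) p (X p)
    - g.leviCivita (fun q ↦ g.leviCivita Z q (X q)) p (Y p)
    - g.leviCivita Z p (mlieBracket I X Y p)

/-- The curvature tensor `R_p(u,v)w` at a point, computed by extending `u`, `v`, `w` to vector
fields that are smooth near `p`; as `R` is a tensor, the choice of the extensions is immaterial. -/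
noncomputable def curvatureTensor (p : M) (u v w : TangentSpace I p) : TangentSpace I p :=
  g.curvature (extend E u) (extend E v) (extend E w) p

/-- `u`, `v` span a plane on which `g` is nondegenerate (this forces linear independence). -/
def IsNondegeneratePlane (p : M) (u v : TangentSpace I p) : Prop :=
  g.val p u u * g.val p v v - g.val p u v ^ 2 ≠ 0

/-- The sectional curvature of the nondegenerate plane spanned by `u` and `v`. -/
noncomputable def sectionalCurvature (p : M) (u v : TangentSpace I p) : ℝ :=
  g.val p (g.curvatureTensor p u v v) u / (g.val p u u * g.val p v v - g.val p u v ^ 2)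

end PseudoRiemannianMetric

/-- The exterior derivative of a 1-form, with the normalization
`dη(X,Y) = ½ (X η(Y) - Y η(X) - η([X,Y]))`. -/
noncomputable def halfExtDeriv (η : Π p : M, TangentSpace I p →L[ℝ] ℝ)
    (X Y : Π p : M, TangentSpace I p) (p : M) : ℝ :=
  (1 / 2) * (d% (fun q ↦ η q (Y q)) p (X p) - d% (fun q ↦ η q (X q)) p (Y p)
    - η p (mlieBracket I X Y p))

/-- The Lie derivative of an endomorphism field: `(𝓛_ξ φ) X = [ξ, φ X] - φ [ξ, X]`. -/
noncomputable def lieDerivEndFun (ξ : Π p : M, TangentSpace I p)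
    (φ : Π p : M, TangentSpace I p →L[ℝ] TangentSpace I p)
    (X : Π p : M, TangentSpace I p) (p : M) : TangentSpace I p :=
  mlieBracket I ξ (fun q ↦ φ q (X q)) p - φ p (mlieBracket I ξ X p)

lemma tensorialAt_lieDerivEndFun (ξ : Π p : M, TangentSpace I p)
    {φ : Π p : M, TangentSpace I p →L[ℝ] TangentSpace I p}
    (hφ : ContMDiff I (I.prod 𝓘(ℝ, E →L[ℝ] E)) ∞
      (fun p ↦ Bundle.TotalSpace.mk' (E →L[ℝ] E) p (φ p))) (p : M) :
    TensorialAt I E (fun X ↦ lieDerivEndFun ξ φ X p) p := by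
  have hd {X : Π p : M, TangentSpace I p} (hX : MDiffAt (T% X) p) :
      MDiffAt (T% (fun q ↦ φ q (X q))) p :=
    MDifferentiableAt.clm_bundle_apply (F₁ := E) (F₂ := E)
      (hφ.mdifferentiableAt (by simp) (x := p)) hX
  constructor
  · intro f X hf hX
    have h : (fun q ↦ φ q ((f • X) q)) = f • (fun q ↦ φ q (X q)) := by
      ext q; simp
    simp only [lieDerivEndFun]
    rw [h, mlieBracket_smul_right hf (hd hX), mlieBracket_smul_right hf hX]
    simp
    module
  · intro X X' hX hX'
    have h : (fun q ↦ φ q ((X + X') q)) = (fun q ↦ φ q (X q)) + (fun q ↦ φ q (X' q)) := by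
      ext q; simp
    simp only [lieDerivEndFun]
    rw [h, mlieBracket_add_right (hd hX) (hd hX'), mlieBracket_add_right hX hX']
    simp
    module

/-- The Lie derivative `𝓛_ξ φ` of a smooth endomorphism field as an endomorphism of `T_p M`: it
sends `X p` to `([ξ, φ X] - φ [ξ, X])(p)`. -/
noncomputable def lieDerivEnd (ξ : Π p : M, TangentSpace I p)
    (φ : Π p : M, TangentSpace I p →L[ℝ] TangentSpace I p)
    (hφ : ContMDiff I (I.prod 𝓘(ℝ, E →L[ℝ] E)) ∞
      (fun p ↦ Bundle.TotalSpace.mk' (E →L[ℝ] E) p (φ p))) (p : M) :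
    TangentSpace I p →L[ℝ] TangentSpace I p :=
  TensorialAt.mkHom (fun X ↦ lieDerivEndFun ξ φ X p) p (tensorialAt_lieDerivEndFun ξ hφ p)

end Geometry

/-! ### Paracontact metric structures -/

/-- An almost paracontact structure `(φ, ξ, η)` on a manifold of dimension `2n+1`. The `±1`
eigenspaces of `φ p` are automatically contained in `ker (η p)` because `η ∘ φ = 0`. -/
structure AlmostParacontactStructure (n : ℕ) (M : Type*) [TopologicalSpace M]
    [ChartedSpace (EuclideanSpace ℝ (Fin (2 * n + 1))) M]
    [IsManifold (𝓡 (2 * n + 1)) ∞ M] where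
  φ (p : M) : TangentSpace (𝓡 (2 * n + 1)) p →L[ℝ] TangentSpace (𝓡 (2 * n + 1)) p
  ξ (p : M) : TangentSpace (𝓡 (2 * n + 1)) p
  η (p : M) : TangentSpace (𝓡 (2 * n + 1)) p →L[ℝ] ℝ
  smooth_φ : ContMDiff (𝓡 (2 * n + 1)) ((𝓡 (2 * n + 1)).prod
      𝓘(ℝ, EuclideanSpace ℝ (Fin (2 * n + 1)) →L[ℝ] EuclideanSpace ℝ (Fin (2 * n + 1)))) ∞
    (fun p ↦ Bundle.TotalSpace.mk'
      (EuclideanSpace ℝ (Fin (2 * n + 1)) →L[ℝ] EuclideanSpace ℝ (Fin (2 * n + 1))) p (φ p))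
  smooth_ξ : ContMDiff (𝓡 (2 * n + 1)) (𝓡 (2 * n + 1)).tangent ∞
    (fun p ↦ Bundle.TotalSpace.mk' (EuclideanSpace ℝ (Fin (2 * n + 1))) p (ξ p))
  smooth_η : ContMDiff (𝓡 (2 * n + 1)) ((𝓡 (2 * n + 1)).prod
      𝓘(ℝ, EuclideanSpace ℝ (Fin (2 * n + 1)) →L[ℝ] ℝ)) ∞
    (fun p ↦ Bundle.TotalSpace.mk' (EuclideanSpace ℝ (Fin (2 * n + 1)) →L[ℝ] ℝ)
      (E := fun p ↦ TangentSpace (𝓡 (2 * n + 1)) p →L[ℝ] Bundle.Trivial M ℝ p) p (η p))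
  φ_ξ (p : M) : φ p (ξ p) = 0
  η_φ (p : M) (u : TangentSpace (𝓡 (2 * n + 1)) p) : η p (φ p u) = 0
  η_ξ (p : M) : η p (ξ p) = 1
  φ_φ (p : M) (u : TangentSpace (𝓡 (2 * n + 1)) p) : φ p (φ p u) = u - η p u • ξ p
  finrank_eigenspace_one (p : M) :
    Module.finrank ℝ (Module.End.eigenspace (φ p).toLinearMap (1 : ℝ)) = n
  finrank_eigenspace_neg_one (p : M) :
    Module.finrank ℝ (Module.End.eigenspace (φ p).toLinearMap (-1 : ℝ)) = n

/-- A paracontact metric structure `(φ, ξ, η, g)`: an almost paracontact structure with a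
compatible pseudo-Riemannian metric `g` such that `g(X, φ Y) = dη(X, Y)`. (Both sides of the last
identity are tensors, so it is the same to ask it for smooth vector fields or for vector fields
that are differentiable at the point in question.) -/
structure ParacontactMetricStructure (n : ℕ) (M : Type*) [TopologicalSpace M]
    [ChartedSpace (EuclideanSpace ℝ (Fin (2 * n + 1))) M]
    [IsManifold (𝓡 (2 * n + 1)) ∞ M] extends AlmostParacontactStructure n M where
  g : PseudoRiemannianMetric (𝓡 (2 * n + 1)) M
  compatible (p : M) (u v : TangentSpace (𝓡 (2 * n + 1)) p) :
    g.val p (φ p u) (φ p v) = - g.val p u v + η p u * η p v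
  fundamental_form (p : M) (X Y : Π q : M, TangentSpace (𝓡 (2 * n + 1)) q)
    (hX : MDifferentiableAt (𝓡 (2 * n + 1)) (𝓡 (2 * n + 1)).tangent
      (fun q ↦ Bundle.TotalSpace.mk' (EuclideanSpace ℝ (Fin (2 * n + 1))) q (X q)) p)
    (hY : MDifferentiableAt (𝓡 (2 * n + 1)) (𝓡 (2 * n + 1)).tangent
      (fun q ↦ Bundle.TotalSpace.mk' (EuclideanSpace ℝ (Fin (2 * n + 1))) q (Y q)) p) :
    g.val p (X p) (φ p (Y p)) = halfExtDeriv η X Y p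

namespace ParacontactMetricStructure

variable {n : ℕ} {M : Type*} [TopologicalSpace M]
  [ChartedSpace (EuclideanSpace ℝ (Fin (2 * n + 1))) M] [IsManifold (𝓡 (2 * n + 1)) ∞ M]
  (S : ParacontactMetricStructure n M)

/-- The operator `h = ½ 𝓛_ξ φ`. -/
noncomputable def h (p : M) :
    TangentSpace (𝓡 (2 * n + 1)) p →L[ℝ] TangentSpace (𝓡 (2 * n + 1)) p :=
  (1 / 2 : ℝ) • lieDerivEnd S.ξ S.φ S.smooth_φ p

/-- The paracontact (horizontal) distribution `ker η`. -/
noncomputable def distribution (p : M) : Submodule ℝ (TangentSpace (𝓡 (2 * n + 1)) p) :=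
  LinearMap.ker (S.η p).toLinearMap

/-- The eigenspace `[c]` of `h` at `p`. -/
noncomputable def hEigenspace (p : M) (c : ℝ) : Submodule ℝ (TangentSpace (𝓡 (2 * n + 1)) p) :=
  Module.End.eigenspace (S.h p).toLinearMap c

end ParacontactMetricStructure

/-! ### Foliations -/

/-- A smooth foliation of dimension `k` of an `m`-dimensional manifold, given by a foliated atlas:
smooth charts of `M` that cover `M` and whose changes of coordinates have locally the form
`(x, y) ↦ (a (x, y), b y)`, where `x` stands for the first `k` coordinates and `y` for the
last `m - k` ones (the transverse coordinates). -/
structure Foliation (m k : ℕ) (M : Type*) [TopologicalSpace M]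
    [ChartedSpace (EuclideanSpace ℝ (Fin m)) M] where
  dim_le : k ≤ m
  atlas : Set (OpenPartialHomeomorph M (EuclideanSpace ℝ (Fin m)))
  atlas_subset : atlas ⊆ IsManifold.maximalAtlas (𝓡 m) ∞ M
  cover (p : M) : ∃ e ∈ atlas, p ∈ e.source
  compatible (e e' : OpenPartialHomeomorph M (EuclideanSpace ℝ (Fin m))) (he : e ∈ atlas)
    (he' : e' ∈ atlas) (p : M) (hp : p ∈ e.source) (hp' : p ∈ e'.source) :
    ∃ V ∈ 𝓝 p, V ⊆ e.source ∩ e'.source ∧ ∀ q ∈ V, ∀ q' ∈ V,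
      (∀ i : Fin m, k ≤ i → e q i = e q' i) → ∀ i : Fin m, k ≤ i → e' q i = e' q' i

namespace Foliation

variable {m k : ℕ} {M : Type*} [TopologicalSpace M] [ChartedSpace (EuclideanSpace ℝ (Fin m)) M]
  (F : Foliation m k M)

/-- The leaf through `p`: all points that can be joined to `p` by a continuous path along which the
transverse coordinates of the foliated charts are locally constant, that is, by a path that stays
locally in the plaques (the slices `y = const`). -/
def leaf (p : M) : Set M :=
  {q | ∃ γ : unitInterval → M, Continuous γ ∧ γ 0 = p ∧ γ 1 = q ∧
    ∀ t, ∃ e ∈ F.atlas, γ t ∈ e.source ∧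
      ∀ᶠ s in 𝓝 t, ∀ i : Fin m, k ≤ i → e (γ s) i = e (γ t) i}

/-- The leaves of the foliation. They partition `M`, and the plaques make them injectively immersed
`k`-dimensional submanifolds. -/
def leaves : Set (Set M) := Set.range F.leaf

/-- The tangent space at `p` of the leaf through `p`: the tangent vectors at `p` that are
annihilated by the differentials of the transverse coordinates (i.e. the tangent space of the slice
through `p`; by compatibility every foliated chart around `p` gives the same `k`-dimensional
space). -/
noncomputable def leafTangentSpace (p : M) : Submodule ℝ (TangentSpace (𝓡 m) p) where
  carrier := {v | ∀ e ∈ F.atlas, p ∈ e.source → ∀ i : Fin m, k ≤ i →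
    mvfderiv (𝓡 m) e p v i = 0}
  add_mem' := by
    intro u v hu hv e he hp i hi
    simp [hu e he hp i hi, hv e he hp i hi]
  zero_mem' := by
    intro e he hp i hi
    simp
  smul_mem' := by
    intro c v hv e he hp i hi
    simp [hv e he hp i hi]

end Foliation

set_option linter.unusedSectionVars false

universe u

/-! First claim. The Koszul formula, combined with `𝓛_ξ dη = 0`, gives `∇_X ξ = -φX + φhX`
(`leviCivita_ξ`). Moreover `h` is self-adjoint, anticommutes with `φ`, and `∇_ξ φ = 0`. Put `A = ∇ξ`
and `l = R(·, ξ)ξ = -∇_ξ A - A²`. Since `A + φAφ = -2φ` is parallel along `ξ`, the derivative terms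
cancel in `l + φlφ`, and what remains is `l + φlφ = 2(h² - φ²)` (`curvature_ξ_ξ_φ`). Pairing with
`X` turns the left side into `g(lX, X) - g(lφX, φX)`. Both terms vanish: by hypothesis where the
plane is nondegenerate, otherwise by a polynomial perturbation of `X`. So the self-adjoint operator
`h² - φ²` has zero quadratic form, and `h² = φ²` (`h_h`). As `φ²` is the identity on `ker η`, `h`
restricts there to an involution, which gives the rank and the splitting; `φ` exchanges `[+1]` and
`[-1]`, so both have dimension `n`.

Second claim. `∇ξ` vanishes on `[+1]`, so for sections `X`, `Y` of `[+1]` the curvature `R(X, Y)ξ`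
reduces to `-∇_{[X,Y]} ξ`. Its vanishing, together with `η([X, Y]) = 0`, says that `[X, Y]` is again
in `[+1]` (`mlieBracket_mem_hEigenspace`). The Frobenius theorem then yields a foliation tangent to
`[+1]`.

Frobenius is proved for the range of a smooth projection field `Q` of constant rank, here `½(h² +
h)`. In a chart the ranges of `Q x` near `a` are graphs over the range of `Q a`. The frame fields
obtained this way commute, because their brackets lie in the range of `Q x` and are killed by `Q a`
(`exists_straightening_of_projection`). Commuting fields are integrated simultaneously along rays,
by the equation `z(t) = y + ∫₀ᵗ B(z(s)) x ds`. The inverse function theorem in the space of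
continuous paths makes its solution smooth in `(x, y)`, and commutation identifies the derivative in
`x` (`RadialODE.exists_solution`). The resulting charts form a foliated atlas (`exists_foliation`).
-/

lemma natCast_le_infty (k : ℕ) : (k : ℕ∞ω) ≤ ∞ := by
  exact_mod_cast (le_top : (k : ℕ∞) ≤ ⊤)

lemma inverse_apply_of_eq_id {E : Type*} [NormedAddCommGroup E] [NormedSpace ℝ E]
    {A : E →L[ℝ] E} (h : A = .id ℝ E) (v : E) : A.inverse v = v := by
  rw [h, ContinuousLinearMap.inverse_id]; rfl

/-! ### Smooth vector fields, brackets and derivations -/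

section VectorFieldCalculus

open VectorField FiberBundle

variable {E : Type*} [NormedAddCommGroup E] [NormedSpace ℝ E]
  [CompleteSpace E] {H : Type*} [TopologicalSpace H] {I : ModelWithCorners ℝ E H}
  {M : Type*} [TopologicalSpace M] [ChartedSpace H M] [IsManifold I ∞ M]
  {F : Type*} [NormedAddCommGroup F] [NormedSpace ℝ F]
  {X Y Z : Π p : M, TangentSpace I p} {f : M → F} {p : M}

lemma ContMDiffAt.mvfderiv_apply (hf : CMDiffAt ∞ f p) (hX : CMDiffAt ∞ (T% X) p) :
    CMDiffAt ∞ (fun q ↦ d% f q (X q)) p := by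
  have h1 := hf.mfderiv_const (m := ∞) (by simp)
  have h2 := ContMDiffAt.clm_apply_of_inCoordinates (b₁ := id) (b₂ := f) h1 hX hf
  exact (contMDiff_snd_tangentBundle_modelSpace F 𝓘(ℝ, F)).contMDiffAt.comp p h2

lemma ContMDiffAt.mlieBracket (hX : CMDiffAt ∞ (T% X) p) (hY : CMDiffAt ∞ (T% Y) p) :
    CMDiffAt ∞ (T% (mlieBracket I X Y)) p := by
  have : IsManifold I ((⊤ : ℕ∞) + 1) M := ‹IsManifold I ∞ M›
  have : IsManifold I (minSmoothness ℝ 3) M :=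
    IsManifold.of_le (n := ∞) (by simpa using natCast_le_infty 3)
  exact ContMDiffAt.mlieBracket_vectorField (n := (⊤ : ℕ∞)) (m := (⊤ : ℕ∞)) hX hY (by simp)

lemma mlieBracket_jacobi (hX : CMDiffAt ∞ (T% X) p) (hY : CMDiffAt ∞ (T% Y) p)
    (hZ : CMDiffAt ∞ (T% Z) p) :
    mlieBracket I X (mlieBracket I Y Z) p =
      mlieBracket I (mlieBracket I X Y) Z p + mlieBracket I Y (mlieBracket I X Z) p := by
  have : IsManifold I (minSmoothness ℝ 3) M :=
    IsManifold.of_le (n := ∞) (by simpa using natCast_le_infty 3)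
  have h2 : minSmoothness ℝ 2 ≤ ∞ := by simpa using natCast_le_infty 2
  exact leibniz_identity_mlieBracket_apply (hX.of_le h2) (hY.of_le h2) (hZ.of_le h2)

/-- The differential of a function, read in the chart at `p`. -/
lemma mvfderiv_extChartAt_symm [I.Boundaryless] {y : E} (hy : y ∈ (extChartAt I p).target)
    (hf : MDiffAt f ((extChartAt I p).symm y))
    (v : TangentSpace I ((extChartAt I p).symm y)) :
    d% f ((extChartAt I p).symm y) v =
      fderiv ℝ (f ∘ (extChartAt I p).symm) y
        ((mfderiv[Set.range I] (extChartAt I p).symm y).inverse v) := by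
  have hI1 : IsManifold I 1 M := IsManifold.of_le (n := ∞) (by simp)
  have hr : Set.range I = Set.univ := I.range_eq_univ
  obtain ⟨e, he⟩ := isInvertible_mfderivWithin_extChartAt_symm (I := I) hy
  have h1 := mfderiv_comp_mfderivWithin (I := 𝓘(ℝ, E)) (I' := I) (s := Set.range I) y hf
    (mdifferentiableWithinAt_extChartAt_symm hy) (by rw [hr]; exact uniqueMDiffWithinAt_univ _)
  rw [← he] at h1 ⊢
  rw [hr, mfderivWithin_univ, mfderiv_eq_fderiv] at h1
  rw [h1, ContinuousLinearMap.inverse_equiv]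
  change _ = mfderiv% f _ (e (e.symm v))
  rw [e.apply_symm_apply]
  rfl

/-- Derivation along `[X, Y]` is the commutator of the derivations along `X` and `Y`. -/
lemma mvfderiv_mlieBracket [I.Boundaryless] (hf : CMDiffAt ∞ f p) (hX : CMDiffAt ∞ (T% X) p)
    (hY : CMDiffAt ∞ (T% Y) p) :
    d% f p (mlieBracket I X Y p) =
      d% (fun q ↦ d% f q (Y q)) p (X p) - d% (fun q ↦ d% f q (X q)) p (Y p) := by
  have hI2 : IsManifold I 2 M := IsManifold.of_le (n := ∞) (natCast_le_infty 2)
  have hI1 : IsManifold I 1 M := IsManifold.of_le (n := ∞) (by simp)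
  have hr : Set.range I = Set.univ := I.range_eq_univ
  let φ := extChartAt I p
  let L (X : Π p : M, TangentSpace I p) : E → E :=
    mpullbackWithin 𝓘(ℝ, E) I φ.symm X (Set.range I)
  have dL {X} (hX : CMDiffAt ∞ (T% X) p) : DifferentiableAt ℝ (L X) (φ p) := by
    have := (hX.mdifferentiableAt (by simp)).mdifferentiableWithinAt (s := Set.univ)
    have := this.differentiableWithinAt_mpullbackWithin_vectorField
    rw [Set.preimage_univ, Set.univ_inter] at this
    exact this.differentiableAt (by rw [hr]; exact Filter.univ_mem)
  have cf : ContDiffAt ℝ ∞ (f ∘ φ.symm) (φ p) := by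
    have := (contMDiffAt_iff.1 hf).2
    rw [hr] at this
    exact this.contDiffAt Filter.univ_mem
  have hev : ∀ᶠ y in 𝓝 (φ p), y ∈ φ.target ∧ MDiffAt f (φ.symm y) := by
    refine Filter.Eventually.and (extChartAt_target_mem_nhds p) ?_
    have h1 : ∀ᶠ q in 𝓝 p, MDiffAt f q :=
      ((contMDiffAt_iff_contMDiffAt_nhds (by simp)).1 (hf.of_le (n := ∞) (m := 1) (by simp))).mono
        fun q hq ↦ hq.mdifferentiableAt (by simp)
    have h2 := (continuousAt_extChartAt_symm (I := I) p).tendsto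
    rw [extChartAt_to_inv] at h2
    exact h2.eventually h1
  have hpt (G : M → F) (hG : MDiffAt G p) (v : TangentSpace I p) :
      d% G p v = fderiv ℝ (G ∘ φ.symm) (φ p) v := by
    rw [hG.mvfderiv, hr, fderivWithin_univ]
    rfl
  have hfield {X} (hX : CMDiffAt ∞ (T% X) p) :
      d% (fun q ↦ d% f q (X q)) p = fderiv ℝ (fun y ↦ fderiv ℝ (f ∘ φ.symm) y (L X y)) (φ p) := by
    ext v
    rw [hpt _ ((hf.mvfderiv_apply hX).mdifferentiableAt (by simp))]
    congr 1
    apply Filter.EventuallyEq.fderiv_eq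
    filter_upwards [hev] with y hy
    exact mvfderiv_extChartAt_symm hy.1 hy.2 _
  -- In coordinates the claim is the symmetry of the second derivative of `f ∘ φ.symm`.
  have key := fderiv_apply_lieBracket cf (n := ∞) (by simpa using natCast_le_infty 2) (dL hY) (dL hX)
  -- The chart at `p` has the identity as derivative at `p`, so a field and its coordinate
  -- expression agree there.
  have hL (X : Π p : M, TangentSpace I p) : L X (φ p) = X p := by
    have h0 : φ.symm (φ p) = p := extChartAt_to_inv p
    have h1 : (mfderiv[Set.range I] φ.symm (φ p) : E →L[ℝ] E) = .id ℝ E :=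
      mfderivWithin_range_extChartAt_symm
    exact (inverse_apply_of_eq_id (E := E) h1 (X (φ.symm (φ p)))).trans (congrArg (fun q ↦ (X q : E)) h0)
  rw [hfield hX, hfield hY, hpt _ (hf.mdifferentiableAt (by simp))]
  rw [hL, hL] at key
  refine Eq.trans ?_ key
  congr 1
  have h3 := mlieBracketWithin_apply (I := I) (V := X) (W := Y) (s := Set.univ) (x₀ := p)
  rw [mlieBracketWithin_univ] at h3
  have h1 : (mfderiv% (extChartAt I p) p : E →L[ℝ] E) = .id ℝ E := mfderiv_extChartAt_self
  refine h3.trans ?_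
  refine (inverse_apply_of_eq_id (E := E) h1 _).trans ?_
  rw [Set.preimage_univ, Set.univ_inter]
  change lieBracketWithin ℝ (L X) (L Y) (Set.range I) (φ p) = _
  rw [hr, lieBracketWithin_univ]

end VectorFieldCalculus

/-! ### Smoothness of the Levi-Civita connection -/

section LeviCivitaCalculus

open VectorField FiberBundle

variable {E : Type*} [NormedAddCommGroup E] [NormedSpace ℝ E] [FiniteDimensional ℝ E]
  [CompleteSpace E] {H : Type*} [TopologicalSpace H] {I : ModelWithCorners ℝ E H}
  {M : Type*} [TopologicalSpace M] [ChartedSpace H M] [IsManifold I ∞ M]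
  {F : Type*} [NormedAddCommGroup F] [NormedSpace ℝ F]
  {X Y Z W : Π p : M, TangentSpace I p} {f f' : M → F} {p : M}

lemma ContMDiffAt.eventually_mdifferentiableAt
    {N : Type*} [TopologicalSpace N] {H' : Type*} [TopologicalSpace H'] {E' : Type*}
    [NormedAddCommGroup E'] [NormedSpace ℝ E'] {I' : ModelWithCorners ℝ E' H'} [ChartedSpace H' N]
    [IsManifold I' 1 N] {f : M → N}
    (hf : ContMDiffAt I I' ∞ f p) : ∀ᶠ q in 𝓝 p, MDifferentiableAt I I' f q := by
  have hI1 : IsManifold I 1 M := IsManifold.of_le (n := ∞) (by simp)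
  exact ((contMDiffAt_iff_contMDiffAt_nhds (by simp)).1 (hf.of_le (n := ∞) (m := 1) (by simp))).mono
        fun q hq ↦ hq.mdifferentiableAt (by simp)

lemma Filter.EventuallyEq.mvfderiv_eq (h : f =ᶠ[𝓝 p] f') : d% f p = d% f' p := by
  ext v
  exact congrArg (fun A : TangentSpace I p →L[ℝ] F ↦ A v) h.mfderiv_eq

/-- A family of linear maps on a finite-dimensional space is smooth if it is pointwise smooth. -/
lemma contMDiffAt_clm_of_apply {V : Type*} [NormedAddCommGroup V] [NormedSpace ℝ V]
    [FiniteDimensional ℝ V] {A : M → V →L[ℝ] F}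
    (h : ∀ v, CMDiffAt ∞ (fun q ↦ A q v) p) : CMDiffAt ∞ A p := by
  let b := Module.finBasis ℝ V
  have hA : A = fun q ↦ ∑ i, ContinuousLinearMap.smulRightL ℝ V F
      (LinearMap.toContinuousLinearMap (b.coord i)) (A q (b i)) := by
    ext q v
    have h1 : A q v = A q (∑ i, b.repr v i • b i) := by rw [b.sum_repr]
    simp only [map_sum, map_smul] at h1
    simpa using h1
  rw [hA]
  refine ContMDiffAt.sum fun i _ ↦ ?_
  exact (ContinuousLinearMap.contMDiff _).contMDiffAt.comp p (h (b i))

variable (I) in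
/-- The frame map `E → T_q M` given by the trivialization of `TM` at `p`. -/
noncomputable def tangentFrame (p q : M) : E →L[ℝ] TangentSpace I q :=
  (trivializationAt E (TangentSpace I) p).symmL ℝ q

variable (I) in
/-- The inverse of the frame map `tangentFrame`, for `q` near `p`. -/
noncomputable def tangentCoframe (p q : M) : TangentSpace I q →L[ℝ] E :=
  (trivializationAt E (TangentSpace I) p).continuousLinearMapAt ℝ q

lemma tangentFrame_coframe {q : M} (hq : q ∈ (chartAt H p).source) (v : TangentSpace I q) :
    tangentFrame I p q (tangentCoframe I p q v) = v :=
  (trivializationAt E (TangentSpace I) p).symmL_continuousLinearMapAt (by simpa using hq) v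

lemma tangentCoframe_frame {q : M} (hq : q ∈ (chartAt H p).source) (v : E) :
    tangentCoframe I p q (tangentFrame I p q v) = v :=
  (trivializationAt E (TangentSpace I) p).continuousLinearMapAt_symmL (by simpa using hq) v

lemma contMDiffAt_tangentFrame_of_mem {c : M → E} {p' : M} (hp : p' ∈ (chartAt H p).source)
    (hc : CMDiffAt ∞ c p') : CMDiffAt ∞ (T% (fun q ↦ tangentFrame I p q (c q))) p' := by
  have h1 := (trivializationAt E (TangentSpace I) p).contMDiffAt_symmL (IB := I) (n := ∞)
    (x := p') (by simpa using hp)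
  have h2 : ContMDiffAt I (I.prod 𝓘(ℝ, E)) ∞
      (fun q ↦ Bundle.TotalSpace.mk' E (E := Bundle.Trivial M E) q (c q)) p' := by
    rw [Bundle.contMDiffAt_section]
    exact hc
  exact ContMDiffAt.clm_bundle_apply (E₁ := Bundle.Trivial M E) (b := id) h1 h2

lemma contMDiffAt_tangentCoframe_of_mem {p' : M}
    (hp : p' ∈ (chartAt H p).source) (hX : CMDiffAt ∞ (T% X) p') :
    CMDiffAt ∞ (fun q ↦ tangentCoframe I p q (X q)) p' := by
  have hb : p' ∈ (trivializationAt E (TangentSpace I) p).baseSet := by simpa using hp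
  refine (((trivializationAt E (TangentSpace I) p).contMDiffAt_section_iff
    hb).1 hX).congr_of_eventuallyEq ?_
  filter_upwards [(trivializationAt E (TangentSpace I) p).open_baseSet.mem_nhds hb] with q hq
  rw [tangentCoframe, Bundle.Trivialization.continuousLinearMapAt_apply,
    Bundle.Trivialization.linearMapAt_apply, if_pos hq]

lemma contMDiffAt_tangentFrame {c : M → E} (hc : CMDiffAt ∞ c p) :
    CMDiffAt ∞ (T% (fun q ↦ tangentFrame I p q (c q))) p :=
  contMDiffAt_tangentFrame_of_mem (mem_chart_source H p) hc

namespace PseudoRiemannianMetric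

variable (g : PseudoRiemannianMetric I M)

lemma contMDiffAt_apply (hX : CMDiffAt ∞ (T% X) p) (hY : CMDiffAt ∞ (T% Y) p) :
    CMDiffAt ∞ (fun q ↦ g.val q (X q) (Y q)) p := by
  have h := ContMDiffAt.clm_bundle_apply₂ (F₁ := E) (F₂ := E) (E₃ := Bundle.Trivial M ℝ)
    (F₃ := ℝ) (g.smooth p) hX hY
  exact ((Bundle.contMDiffAt_totalSpace ..).1 h).2

/-- The Gram form of the metric in the frame `tangentFrame I p`. -/
noncomputable def gram (p q : M) : E →L[ℝ] E →L[ℝ] ℝ :=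
  LinearMap.toContinuousLinearMap
    { toFun := fun v ↦ (g.val q (tangentFrame I p q v)).comp (tangentFrame I p q)
      map_add' := fun v w ↦ by ext; simp
      map_smul' := fun c v ↦ by ext; simp }

/-- A vector field is smooth if its products with smooth fields are smooth. -/
lemma contMDiffAt_of_forall_apply
    (h : ∀ V : Π p : M, TangentSpace I p, CMDiffAt ∞ (T% V) p →
      CMDiffAt ∞ (fun q ↦ g.val q (X q) (V q)) p) : CMDiffAt ∞ (T% X) p := by
  have hfr (v : E) : CMDiffAt ∞ (T% (fun q ↦ tangentFrame I p q v)) p :=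
    contMDiffAt_tangentFrame contMDiffAt_const
  have hsrc : ∀ᶠ q in 𝓝 p, q ∈ (chartAt H p).source := chart_source_mem_nhds H p
  have hG : CMDiffAt ∞ (g.gram p) p :=
    contMDiffAt_clm_of_apply fun v ↦ contMDiffAt_clm_of_apply fun w ↦
      g.contMDiffAt_apply (hfr v) (hfr w)
  have hω : CMDiffAt ∞ (fun q ↦ (g.val q (X q)).comp (tangentFrame I p q)) p :=
    contMDiffAt_clm_of_apply fun w ↦ h _ (hfr w)
  have hinj (q : M) (hq : q ∈ (chartAt H p).source) : Function.Injective (g.gram p q) := by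
    refine (injective_iff_map_eq_zero _).2 fun v hv ↦ ?_
    have h0 : tangentFrame I p q v = 0 := g.nondegenerate q _ fun w ↦ by
      rw [← tangentFrame_coframe hq w]
      exact congr($hv (tangentCoframe I p q w))
    rw [← tangentCoframe_frame (I := I) hq v, h0, map_zero]
  have hdim : Module.finrank ℝ E = Module.finrank ℝ (E →L[ℝ] ℝ) := by
    rw [← (LinearMap.toContinuousLinearMap (𝕜 := ℝ) (E := E) (F' := ℝ)).finrank_eq]
    exact Subspace.dual_finrank_eq.symm
  have hequiv (q : M) (hq : q ∈ (chartAt H p).source) :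
      ∃ e : E ≃L[ℝ] (E →L[ℝ] ℝ), (e : E →L[ℝ] E →L[ℝ] ℝ) = g.gram p q := by
    refine ⟨(LinearEquiv.ofBijective (g.gram p q).toLinearMap ⟨hinj q hq,
      (LinearMap.injective_iff_surjective_of_finrank_eq_finrank hdim).1 (hinj q hq)⟩).toContinuousLinearEquiv, ?_⟩
    ext; rfl
  have hinv : CMDiffAt ∞ (fun q ↦ (g.gram p q).inverse) p := by
    obtain ⟨e, he⟩ := hequiv p (mem_chart_source H p)
    have h1 := contDiffAt_map_inverse (𝕜 := ℝ) (n := ∞) e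
    rw [he] at h1
    exact h1.contMDiffAt.comp p hG
  -- The coordinates of `X` in the frame, recovered from its products with the frame by inverting
  -- the Gram form.
  have hc : CMDiffAt ∞ (fun q ↦ (g.gram p q).inverse ((g.val q (X q)).comp (tangentFrame I p q))) p :=
    hinv.clm_apply hω
  refine (contMDiffAt_tangentFrame hc).congr_of_eventuallyEq ?_
  filter_upwards [hsrc] with q hq
  obtain ⟨e, he⟩ := hequiv q hq
  have h2 : (g.val q (X q)).comp (tangentFrame I p q) = g.gram p q (tangentCoframe I p q (X q)) := by
    ext w
    simp [gram, tangentFrame_coframe hq]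
  rw [h2, ← he, ContinuousLinearMap.inverse_equiv]
  simp [tangentFrame_coframe hq]

lemma contMDiffAt_koszul (hX : CMDiffAt ∞ (T% X) p) (hY : CMDiffAt ∞ (T% Y) p)
    (hZ : CMDiffAt ∞ (T% Z) p) : CMDiffAt ∞ (g.koszul X Y Z) p := by
  unfold koszul
  have h1 := (g.contMDiffAt_apply hY hZ).mvfderiv_apply hX
  have h2 := (g.contMDiffAt_apply hX hZ).mvfderiv_apply hY
  have h3 := (g.contMDiffAt_apply hX hY).mvfderiv_apply hZ
  have h4 := g.contMDiffAt_apply (hX.mlieBracket hY) hZ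
  have h5 := g.contMDiffAt_apply (hX.mlieBracket hZ) hY
  have h6 := g.contMDiffAt_apply (hY.mlieBracket hZ) hX
  exact ((((h1.add h2).sub h3).add h4).sub h5).sub h6

/-- The connection is defined pointwise by duality, so smoothness is tested against smooth fields
`V`: there the Koszul formula expresses the product by derivatives and brackets of smooth data. -/
lemma contMDiffAt_leviCivita (hX : CMDiffAt ∞ (T% X) p) (hY : CMDiffAt ∞ (T% Y) p) :
    CMDiffAt ∞ (T% (fun q ↦ g.leviCivita Y q (X q))) p := by
  refine g.contMDiffAt_of_forall_apply fun V hV ↦ ?_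
  refine ((contMDiffAt_const (c := (1 / 2 : ℝ))).mul
    (g.contMDiffAt_koszul hX hY hV)).congr_of_eventuallyEq ?_
  have hI : IsManifold I 1 M := IsManifold.of_le (n := ∞) (by simp)
  filter_upwards [hX.eventually_mdifferentiableAt, hY.eventually_mdifferentiableAt,
    hV.eventually_mdifferentiableAt] with q h1 h2 h3
  have := g.leviCivitaFun_spec h1 h2 h3
  change g.val q (g.leviCivitaFun Y q (X q)) (V q) = _
  simp only [Pi.mul_apply]
  linarith

end PseudoRiemannianMetric

end LeviCivitaCalculus

/-! ### Symmetries and tensoriality of the curvature -/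

section CurvatureSymmetries

open VectorField FiberBundle

variable {E : Type*} [NormedAddCommGroup E] [NormedSpace ℝ E] [FiniteDimensional ℝ E]
  [CompleteSpace E] {H : Type*} [TopologicalSpace H] {I : ModelWithCorners ℝ E H}
  {M : Type*} [TopologicalSpace M] [T2Space M] [ChartedSpace H M] [IsManifold I ∞ M]
  {X X' Y Y' Z Z' W : Π p : M, TangentSpace I p} {p : M}

namespace PseudoRiemannianMetric

variable (g : PseudoRiemannianMetric I M)

lemma leviCivita_congr (hX : CMDiffAt ∞ (T% X) p) (hY : CMDiffAt ∞ (T% Y) p)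
    (h : ∀ᶠ q in 𝓝 p, X q = Y q) : g.leviCivita X p = g.leviCivita Y p :=
  g.leviCivita.isCovariantDerivativeOnUniv.congr_of_eventuallyEq
    (hX.mdifferentiableAt (by simp)) (hY.mdifferentiableAt (by simp)) Filter.univ_mem h

lemma leviCivita_sub (hX : CMDiffAt ∞ (T% X) p) (hY : CMDiffAt ∞ (T% Y) p) :
    g.leviCivita (X - Y) p = g.leviCivita X p - g.leviCivita Y p := by
  have h1 := g.leviCivita.isCovariantDerivativeOnUniv.add
    ((hX.sub_section hY).mdifferentiableAt (by simp)) (hY.mdifferentiableAt (by simp))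
  change g.leviCivita (X - Y + Y) p = g.leviCivita (X - Y) p + g.leviCivita Y p at h1
  rw [sub_add_cancel] at h1
  rw [h1, add_sub_cancel_right]

lemma mvfderiv_apply_eventuallyEq (hX : CMDiffAt ∞ (T% X) p) (hY : CMDiffAt ∞ (T% Y) p)
    (hZ : CMDiffAt ∞ (T% Z) p) :
    (fun q ↦ d% (fun q ↦ g.val q (Y q) (Z q)) q (X q)) =ᶠ[𝓝 p]
      (fun q ↦ g.val q (g.leviCivita Y q (X q)) (Z q)) +
        fun q ↦ g.val q (Y q) (g.leviCivita Z q (X q)) := by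
  have hI : IsManifold I 1 M := IsManifold.of_le (n := ∞) (by simp)
  filter_upwards [hX.eventually_mdifferentiableAt, hY.eventually_mdifferentiableAt,
    hZ.eventually_mdifferentiableAt] with q h1 h2 h3
  exact g.leviCivita_metric h1 h2 h3

/-- Two applications of metric compatibility. The two mixed terms are exchanged when `X` and `Y` are
swapped, so they drop out of the commutator in `curvature_skew`. -/
lemma mvfderiv_mvfderiv_apply (hX : CMDiffAt ∞ (T% X) p) (hY : CMDiffAt ∞ (T% Y) p)
    (hZ : CMDiffAt ∞ (T% Z) p) (hW : CMDiffAt ∞ (T% W) p) :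
    d% (fun q ↦ d% (fun q ↦ g.val q (Z q) (W q)) q (Y q)) p (X p) =
      g.val p (g.leviCivita (fun q ↦ g.leviCivita Z q (Y q)) p (X p)) (W p) +
      g.val p (g.leviCivita Z p (Y p)) (g.leviCivita W p (X p)) +
      (g.val p (g.leviCivita Z p (X p)) (g.leviCivita W p (Y p)) +
      g.val p (Z p) (g.leviCivita (fun q ↦ g.leviCivita W q (Y q)) p (X p))) := by
  have hYZ := g.contMDiffAt_leviCivita hY hZ
  have hYW := g.contMDiffAt_leviCivita hY hW
  rw [(g.mvfderiv_apply_eventuallyEq hY hZ hW).mvfderiv_eq,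
    mvfderiv_add ((g.contMDiffAt_apply hYZ hW).mdifferentiableAt (by simp))
      ((g.contMDiffAt_apply hZ hYW).mdifferentiableAt (by simp)), add_apply,
    g.leviCivita_metric (hX.mdifferentiableAt (by simp)) (hYZ.mdifferentiableAt (by simp))
      (hW.mdifferentiableAt (by simp)),
    g.leviCivita_metric (hX.mdifferentiableAt (by simp)) (hZ.mdifferentiableAt (by simp))
      (hYW.mdifferentiableAt (by simp))]

/-- The curvature is skew-symmetric with respect to the metric. -/
lemma curvature_skew [I.Boundaryless] (hX : CMDiffAt ∞ (T% X) p) (hY : CMDiffAt ∞ (T% Y) p)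
    (hZ : CMDiffAt ∞ (T% Z) p) (hW : CMDiffAt ∞ (T% W) p) :
    g.val p (g.curvature X Y Z p) (W p) = - g.val p (g.curvature X Y W p) (Z p) := by
  -- Derivation of the function `g(Z, W)` along `[X, Y]`, computed both directly and as a
  -- commutator.
  have h1 := mvfderiv_mlieBracket (g.contMDiffAt_apply hZ hW) hX hY
  rw [g.mvfderiv_mvfderiv_apply hX hY hZ hW, g.mvfderiv_mvfderiv_apply hY hX hZ hW,
    g.leviCivita_metric ((hX.mlieBracket hY).mdifferentiableAt (by simp))
      (hZ.mdifferentiableAt (by simp)) (hW.mdifferentiableAt (by simp))] at h1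
  rw [g.symm p _ (Z p)]
  simp only [curvature, map_sub, sub_apply]
  linarith

lemma curvature_swap : g.curvature X Y Z p = - g.curvature Y X Z p := by
  simp only [curvature]
  rw [mlieBracket_swap_apply (V := X), map_neg]
  abel

/-- `∇_X ∇_Y Z - ∇_X ∇_Z Y = ∇_X [Y, Z]`. -/
lemma leviCivita_leviCivita_sub (hX : CMDiffAt ∞ (T% X) p) (hY : CMDiffAt ∞ (T% Y) p)
    (hZ : CMDiffAt ∞ (T% Z) p) :
    g.leviCivita (fun q ↦ g.leviCivita Z q (Y q)) p (X p) -
      g.leviCivita (fun q ↦ g.leviCivita Y q (Z q)) p (X p) =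
      g.leviCivita X p (mlieBracket I Y Z p) + mlieBracket I X (mlieBracket I Y Z) p := by
  have hI : IsManifold I 1 M := IsManifold.of_le (n := ∞) (by simp)
  have h1 := g.contMDiffAt_leviCivita hY hZ
  have h2 := g.contMDiffAt_leviCivita hZ hY
  have h3 : ∀ᶠ q in 𝓝 p, ((fun q ↦ g.leviCivita Z q (Y q)) - fun q ↦ g.leviCivita Y q (Z q)) q =
      mlieBracket I Y Z q := by
    filter_upwards [hY.eventually_mdifferentiableAt, hZ.eventually_mdifferentiableAt] with q hq hq'
    exact g.leviCivita_torsion_free hq hq'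
  have h4 := hY.mlieBracket hZ
  have h5 := g.leviCivita_congr (h1.sub_section h2) h4 h3
  rw [g.leviCivita_sub h1 h2] at h5
  have h6 := g.leviCivita_torsion_free (hX.mdifferentiableAt (by simp))
    (h4.mdifferentiableAt (by simp))
  rw [← h6, ← h5]
  simp

/-- The first Bianchi identity. -/
lemma curvature_bianchi (hX : CMDiffAt ∞ (T% X) p) (hY : CMDiffAt ∞ (T% Y) p)
    (hZ : CMDiffAt ∞ (T% Z) p) :
    g.curvature X Y Z p + g.curvature Y Z X p + g.curvature Z X Y p = 0 := by
  -- The six second derivatives are grouped by their outer field. Each pair leaves a term `∇_{[Y,Z]}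
  -- X`, which cancels against the curvature, and a double bracket; the double brackets cancel by
  -- the Jacobi identity.
  have h1 := g.leviCivita_leviCivita_sub hX hY hZ
  have h2 := g.leviCivita_leviCivita_sub hY hZ hX
  have h3 := g.leviCivita_leviCivita_sub hZ hX hY
  have h4 := mlieBracket_jacobi hX hY hZ
  have h5 : mlieBracket I Y (mlieBracket I Z X) p = - mlieBracket I Y (mlieBracket I X Z) p := by
    rw [mlieBracket_swap (V := Z)]
    have := mlieBracket_const_smul_right (V := Y) (c := (-1 : ℝ))
      ((hX.mlieBracket hZ).mdifferentiableAt (by simp))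
    simpa using! this
  have h6 : mlieBracket I Z (mlieBracket I X Y) p = - mlieBracket I (mlieBracket I X Y) Z p :=
    mlieBracket_swap_apply
  rw [h4] at h1
  rw [h5] at h2
  rw [h6] at h3
  simp only [curvature]
  linear_combination (norm := module) h1 + h2 + h3

/-- The classical combination of four Bianchi identities, one for each choice of the slot left out
of the cyclic sum, with skew-symmetry in the first and in the last pair. -/
lemma curvature_pair_symm [I.Boundaryless] (hX : CMDiffAt ∞ (T% X) p) (hY : CMDiffAt ∞ (T% Y) p)
    (hZ : CMDiffAt ∞ (T% Z) p) (hW : CMDiffAt ∞ (T% W) p) :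
    g.val p (g.curvature X Y Z p) (W p) = g.val p (g.curvature Z W X p) (Y p) := by
  have b {X Y Z W : Π p : M, TangentSpace I p} (hX : CMDiffAt ∞ (T% X) p)
      (hY : CMDiffAt ∞ (T% Y) p) (hZ : CMDiffAt ∞ (T% Z) p) :
      g.val p (g.curvature X Y Z p) (W p) + g.val p (g.curvature Y Z X p) (W p) +
        g.val p (g.curvature Z X Y p) (W p) = 0 := by
    have := congr(g.val p $(g.curvature_bianchi hX hY hZ) (W p))
    simpa using this
  have s {X Y Z W : Π p : M, TangentSpace I p} :
      g.val p (g.curvature X Y Z p) (W p) = - g.val p (g.curvature Y X Z p) (W p) := by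
    rw [g.curvature_swap]; simp
  have b1 := b (W := W) hX hY hZ
  have b2 := b (W := X) hY hZ hW
  have b3 := b (W := Y) hZ hW hX
  have b4 := b (W := Z) hW hX hY
  have k1 := g.curvature_skew hX hY hZ hW
  have k2 := g.curvature_skew hY hZ hX hW
  have k3 := g.curvature_skew hZ hX hY hW
  have k4 := g.curvature_skew hZ hW hX hY
  have k5 := g.curvature_skew hW hX hY hZ
  have k6 := g.curvature_skew hY hW hZ hX
  have s1 := s (X := Z) (Y := X) (Z := W) (W := Y)
  have s2 := s (X := W) (Y := X) (Z := Y) (W := Z)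
  have s3 := s (X := W) (Y := Y) (Z := X) (W := Z)
  have s4 := s (X := Z) (Y := W) (Z := X) (W := Y)
  have s5 := s (X := Z) (Y := W) (Z := Y) (W := X)
  have s6 := s (X := W) (Y := Y) (Z := Z) (W := X)
  have s7 := s (X := X) (Y := Z) (Z := W) (W := Y)
  linarith

/-- The curvature at `p` only depends on the values of the fields at `p`. -/
lemma curvature_congr [I.Boundaryless] (hX : CMDiffAt ∞ (T% X) p) (hX' : CMDiffAt ∞ (T% X') p)
    (hY : CMDiffAt ∞ (T% Y) p) (hY' : CMDiffAt ∞ (T% Y') p)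
    (hZ : CMDiffAt ∞ (T% Z) p) (hZ' : CMDiffAt ∞ (T% Z') p)
    (h1 : X p = X' p) (h2 : Y p = Y' p) (h3 : Z p = Z' p) :
    g.curvature X Y Z p = g.curvature X' Y' Z' p := by
  refine g.ext_of_apply fun w ↦ ?_
  have hI : IsManifold I 1 M := IsManifold.of_le (n := ∞) (by simp)
  have hW := contMDiffAt_extend (k := ∞) I E (V := (TangentSpace I : M → Type _)) w
  set W := extend E w with hWdef
  have hw : w = W p := by simp [hWdef]
  rw [hw]
  -- Only the value at `p` of the field paired with the curvature matters. The symmetries move each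
  -- of the three arguments in turn into that slot, which avoids any direct check of linearity over
  -- functions.
  have e1 : g.val p (g.curvature X Y Z p) (W p) = g.val p (g.curvature X Y Z' p) (W p) := by
    rw [g.curvature_skew hX hY hZ hW, h3, ← g.curvature_skew hX hY hZ' hW]
  have e2 : g.val p (g.curvature X Y Z' p) (W p) = g.val p (g.curvature X Y' Z' p) (W p) := by
    rw [g.curvature_pair_symm hX hY hZ' hW, h2, ← g.curvature_pair_symm hX hY' hZ' hW]
  have e3 : g.val p (g.curvature X Y' Z' p) (W p) = g.val p (g.curvature X' Y' Z' p) (W p) := by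
    rw [g.curvature_pair_symm hX hY' hZ' hW, g.curvature_skew hZ' hW hX hY', h1,
      ← g.curvature_skew hZ' hW hX' hY', g.curvature_pair_symm hX' hY' hZ' hW]
  rw [e1, e2, e3]

lemma curvatureTensor_eq [I.Boundaryless] (hX : CMDiffAt ∞ (T% X) p) (hY : CMDiffAt ∞ (T% Y) p)
    (hZ : CMDiffAt ∞ (T% Z) p) :
    g.curvatureTensor p (X p) (Y p) (Z p) = g.curvature X Y Z p := by
  have h (v : TangentSpace I p) := contMDiffAt_extend (k := ∞) I E (V := (TangentSpace I : M → Type _)) v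
  exact g.curvature_congr (h _) hX (h _) hY (h _) hZ (by simp) (by simp) (by simp)

end PseudoRiemannianMetric

end CurvatureSymmetries

section

variable {E : Type*} [NormedAddCommGroup E] [NormedSpace ℝ E]
  {H : Type*} [TopologicalSpace H] {I : ModelWithCorners ℝ E H}
  {M : Type*} [TopologicalSpace M] [ChartedSpace H M] [IsManifold I ∞ M]

/-- Smoothness of a vector field at a point. -/
abbrev SmoothFieldAt (X : Π p : M, TangentSpace I p) (p : M) : Prop := CMDiffAt ∞ (T% X) p

/-- Differentiability of a vector field at a point. -/
abbrev DiffFieldAt (X : Π p : M, TangentSpace I p) (p : M) : Prop := MDiffAt (T% X) p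

end

namespace ParacontactMetricStructure

open VectorField FiberBundle

variable {n : ℕ} {M : Type*} [TopologicalSpace M]
  [ChartedSpace (EuclideanSpace ℝ (Fin (2 * n + 1))) M] [IsManifold (𝓡 (2 * n + 1)) ∞ M]
  (S : ParacontactMetricStructure n M)
  {X Y Z : Π p : M, TangentSpace (𝓡 (2 * n + 1)) p} {p : M}

/-! ### Algebraic identities and smoothness -/

lemma val_ξ (u : TangentSpace (𝓡 (2 * n + 1)) p) : S.g.val p (S.ξ p) u = S.η p u := by
  have h := S.compatible p (S.ξ p) u
  rw [S.φ_ξ, S.η_ξ] at h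
  simp at h
  linarith

lemma val_ξ_right (u : TangentSpace (𝓡 (2 * n + 1)) p) : S.g.val p u (S.ξ p) = S.η p u := by
  rw [S.g.symm, S.val_ξ]

lemma val_φ_left (u v : TangentSpace (𝓡 (2 * n + 1)) p) :
    S.g.val p (S.φ p u) v = - S.g.val p u (S.φ p v) := by
  have h := S.compatible p u (S.φ p v)
  rw [S.φ_φ, S.η_φ] at h
  simp [S.val_ξ_right, S.η_φ] at h
  linarith

lemma contMDiffAt_ξ : SmoothFieldAt S.ξ p := S.smooth_ξ p

lemma contMDiffAt_φ (hX : SmoothFieldAt X p) : SmoothFieldAt ((fun q ↦ S.φ q (X q))) p :=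
  ContMDiffAt.clm_bundle_apply (b := id) (S.smooth_φ p) hX

lemma contMDiffAt_η (hX : SmoothFieldAt X p) :
    ContMDiffAt (𝓡 (2 * n + 1)) 𝓘(ℝ, ℝ) ∞ (fun q ↦ S.η q (X q)) p := by
  have h := ContMDiffAt.clm_bundle_apply (b := id) (E₂ := Bundle.Trivial M ℝ) (F₂ := ℝ)
    (S.smooth_η p) hX
  exact ((Bundle.contMDiffAt_totalSpace ..).1 h).2

lemma h_apply (hX : DiffFieldAt X p) :
    S.h p (X p) = (1 / 2 : ℝ) • (mlieBracket (𝓡 (2 * n + 1)) S.ξ (fun q ↦ S.φ q (X q)) p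
      - S.φ p (mlieBracket (𝓡 (2 * n + 1)) S.ξ X p)) := by
  have h1 := TensorialAt.mkHom_apply (tensorialAt_lieDerivEndFun S.ξ S.smooth_φ p) hX
  change (1 / 2 : ℝ) • lieDerivEnd S.ξ S.φ S.smooth_φ p (X p) = _
  rw [lieDerivEnd, h1, lieDerivEndFun]

lemma contMDiffAt_h (hX : SmoothFieldAt X p) : SmoothFieldAt ((fun q ↦ S.h q (X q))) p := by
  have h1 := ((S.contMDiffAt_ξ (p := p)).mlieBracket (S.contMDiffAt_φ hX)).sub_section
    (S.contMDiffAt_φ ((S.contMDiffAt_ξ (p := p)).mlieBracket hX))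
  refine (h1.const_smul_section (a := (1 / 2 : ℝ))).congr_of_eventuallyEq ?_
  have hI : IsManifold (𝓡 (2 * n + 1)) 1 M := IsManifold.of_le (n := ∞) (by simp)
  filter_upwards [hX.eventually_mdifferentiableAt] with q hq
  rw [S.h_apply hq]
  rfl

/-! ### The form `η` and brackets -/

lemma η_mlieBracket (hX : DiffFieldAt X p) (hY : DiffFieldAt Y p) :
    S.η p (mlieBracket (𝓡 (2 * n + 1)) X Y p) =
      mvfderiv (𝓡 (2 * n + 1)) (fun q ↦ S.η q (Y q)) p (X p)
      - mvfderiv (𝓡 (2 * n + 1)) (fun q ↦ S.η q (X q)) p (Y p)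
      - 2 * S.g.val p (X p) (S.φ p (Y p)) := by
  rw [S.fundamental_form p X Y hX hY, halfExtDeriv]
  ring

/-- This is `𝓛_ξ η = 0`: `dη(ξ, X) = g(ξ, φX) = η(φX) = 0`, and `η(ξ)` is constant. -/
lemma η_mlieBracket_ξ (hX : DiffFieldAt X p) :
    S.η p (mlieBracket (𝓡 (2 * n + 1)) S.ξ X p) =
      mvfderiv (𝓡 (2 * n + 1)) (fun q ↦ S.η q (X q)) p (S.ξ p) := by
  have hc : (fun q ↦ S.η q (S.ξ q)) = fun _ ↦ (1 : ℝ) := funext S.η_ξ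
  rw [S.η_mlieBracket (S.contMDiffAt_ξ.mdifferentiableAt (by simp)) hX, hc, mvfderiv_const,
    S.val_ξ, S.η_φ]
  simp

/-- `𝓛_ξ dη = 0`. -/
lemma mvfderiv_val_φ_ξ (hX : SmoothFieldAt X p) (hY : SmoothFieldAt Y p) :
    mvfderiv (𝓡 (2 * n + 1)) (fun q ↦ S.g.val q (X q) (S.φ q (Y q))) p (S.ξ p) =
      S.g.val p (mlieBracket (𝓡 (2 * n + 1)) S.ξ X p) (S.φ p (Y p)) +
        S.g.val p (X p) (S.φ p (mlieBracket (𝓡 (2 * n + 1)) S.ξ Y p)) := by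
  have hI : IsManifold (𝓡 (2 * n + 1)) 1 M := IsManifold.of_le (n := ∞) (by simp)
  have hξ := S.contMDiffAt_ξ (p := p)
  have hηX := S.contMDiffAt_η hX
  have hηY := S.contMDiffAt_η hY
  have hXY := hX.mlieBracket hY
  have hξX := hξ.mlieBracket hX
  have hξY := hξ.mlieBracket hY
  have d0 {f : M → ℝ} (hf : ContMDiffAt (𝓡 (2 * n + 1)) 𝓘(ℝ, ℝ) ∞ f p) :
      MDifferentiableAt (𝓡 (2 * n + 1)) 𝓘(ℝ, ℝ) f p := hf.mdifferentiableAt (by simp)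
  have d1 {X : Π p : M, TangentSpace (𝓡 (2 * n + 1)) p} (hX : SmoothFieldAt X p) :
    DiffFieldAt X p := hX.mdifferentiableAt (by simp)
  have e0 : (fun q ↦ S.g.val q (X q) (S.φ q (Y q))) =ᶠ[𝓝 p] fun q ↦ (1 / 2 : ℝ) •
      (((fun q ↦ mvfderiv (𝓡 (2 * n + 1)) (fun q ↦ S.η q (Y q)) q (X q))
        - (fun q ↦ mvfderiv (𝓡 (2 * n + 1)) (fun q ↦ S.η q (X q)) q (Y q))
        - fun q ↦ S.η q (mlieBracket (𝓡 (2 * n + 1)) X Y q)) q) := by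
    filter_upwards [hX.eventually_mdifferentiableAt, hY.eventually_mdifferentiableAt] with q h1 h2
    rw [S.fundamental_form q X Y h1 h2, halfExtDeriv]
    rfl
  have e1 {Z : Π p : M, TangentSpace (𝓡 (2 * n + 1)) p} (hZ : SmoothFieldAt Z p) :
      (fun q ↦ S.η q (mlieBracket (𝓡 (2 * n + 1)) S.ξ Z q)) =ᶠ[𝓝 p]
        fun q ↦ mvfderiv (𝓡 (2 * n + 1)) (fun q ↦ S.η q (Z q)) q (S.ξ q) := by
    filter_upwards [hZ.eventually_mdifferentiableAt] with q h1
    exact S.η_mlieBracket_ξ h1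
  have dXY := hηY.mvfderiv_apply hX
  have dYX := hηX.mvfderiv_apply hY
  have c1 := mvfderiv_mlieBracket hηY hξ hX
  have c2 := mvfderiv_mlieBracket hηX hξ hY
  have f1 := S.fundamental_form p _ _ (d1 hξX) (d1 hY)
  have f2 := S.fundamental_form p _ _ (d1 hX) (d1 hξY)
  rw [halfExtDeriv, (e1 hX).mvfderiv_eq] at f1
  rw [halfExtDeriv, (e1 hY).mvfderiv_eq] at f2
  -- With `η([ξ, Z]) = ξ(η(Z))`, the two sides differ only by commutators of derivations, supplied
  -- by `c1` and `c2`, and by double brackets, settled by the Jacobi identity.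
  have j := mlieBracket_jacobi hξ hX hY
  have j1 := congr(S.η p $j)
  rw [map_add, S.η_mlieBracket_ξ (d1 hXY)] at j1
  rw [e0.mvfderiv_eq, f1, f2, c1, c2]
  have e2 : mvfderiv (𝓡 (2 * n + 1)) (fun q ↦ (1 / 2 : ℝ) •
      (((fun q ↦ mvfderiv (𝓡 (2 * n + 1)) (fun q ↦ S.η q (Y q)) q (X q))
        - (fun q ↦ mvfderiv (𝓡 (2 * n + 1)) (fun q ↦ S.η q (X q)) q (Y q))
        - fun q ↦ S.η q (mlieBracket (𝓡 (2 * n + 1)) X Y q)) q)) p (S.ξ p) =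
      (1 / 2 : ℝ) *
        (mvfderiv (𝓡 (2 * n + 1)) (fun q ↦ mvfderiv (𝓡 (2 * n + 1)) (fun q ↦ S.η q (Y q)) q (X q)) p
          (S.ξ p) -
        mvfderiv (𝓡 (2 * n + 1)) (fun q ↦ mvfderiv (𝓡 (2 * n + 1)) (fun q ↦ S.η q (X q)) q (Y q)) p
          (S.ξ p) -
        mvfderiv (𝓡 (2 * n + 1)) (fun q ↦ S.η q (mlieBracket (𝓡 (2 * n + 1)) X Y q)) p (S.ξ p)) := by
    have h1 := mvfderiv_smul (mdifferentiableAt_const (c := (1 / 2 : ℝ)) (x := p) (I := 𝓡 (2 * n + 1)))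
      (((d0 dXY).sub (d0 dYX)).sub (d0 (S.contMDiffAt_η hXY)))
    have h2 := mvfderiv_sub ((d0 dXY).sub (d0 dYX)) (d0 (S.contMDiffAt_η hXY))
    have h3 := mvfderiv_sub (d0 dXY) (d0 dYX)
    rw [h2, h3, mvfderiv_const] at h1
    have h4 := congr($h1 (S.ξ p))
    refine h4.trans ?_
    simp
  rw [e2, j1]
  ring

/-- The Lie derivative of `g` along `ξ` is given by `h`. -/
lemma mvfderiv_val_φ_ξ_eq (hX : SmoothFieldAt X p) (hY : SmoothFieldAt Y p) :
    mvfderiv (𝓡 (2 * n + 1)) (fun q ↦ S.g.val q (X q) (S.φ q (Y q))) p (S.ξ p) =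
      S.g.val p (mlieBracket (𝓡 (2 * n + 1)) S.ξ X p) (S.φ p (Y p)) +
        S.g.val p (X p) (mlieBracket (𝓡 (2 * n + 1)) S.ξ (fun q ↦ S.φ q (Y q)) p) -
        2 * S.g.val p (X p) (S.h p (Y p)) := by
  rw [S.mvfderiv_val_φ_ξ hX hY, S.h_apply (hY.mdifferentiableAt (by simp))]
  simp
  ring

/-! ### Properties of `h` -/

lemma contMDiffAt_extend_tangent (u : TangentSpace (𝓡 (2 * n + 1)) p) :
    SmoothFieldAt ((extend (EuclideanSpace ℝ (Fin (2 * n + 1))) u)) p :=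
  contMDiffAt_extend _ _ (V := (TangentSpace (𝓡 (2 * n + 1)) : M → Type _)) u

lemma h_ξ : S.h p (S.ξ p) = 0 := by
  rw [S.h_apply (S.contMDiffAt_ξ.mdifferentiableAt (by simp))]
  have h1 : (fun q ↦ S.φ q (S.ξ q)) = 0 := funext S.φ_ξ
  rw [h1, mlieBracket_zero_right, mlieBracket_self]
  simp

lemma η_h (u : TangentSpace (𝓡 (2 * n + 1)) p) : S.η p (S.h p u) = 0 := by
  have hX := contMDiffAt_extend_tangent u
  rw [← extend_apply_self (EuclideanSpace ℝ (Fin (2 * n + 1))) u]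
  rw [S.h_apply (hX.mdifferentiableAt (by simp)), map_smul, map_sub, S.η_φ,
    S.η_mlieBracket_ξ ((S.contMDiffAt_φ hX).mdifferentiableAt (by simp))]
  have h1 : (fun q ↦ S.η q (S.φ q (extend (EuclideanSpace ℝ (Fin (2 * n + 1))) u q))) =
    fun _ ↦ (0 : ℝ) := funext fun q ↦ S.η_φ q _
  rw [h1, mvfderiv_const]
  simp

/-- Differentiate `φ² = id - η ⊗ ξ` along `ξ`. The right side is invariant because `𝓛_ξ η = 0`, so
`(𝓛_ξ φ)φ + φ(𝓛_ξ φ) = 0`. -/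
lemma h_φ (u : TangentSpace (𝓡 (2 * n + 1)) p) : S.h p (S.φ p u) = - S.φ p (S.h p u) := by
  have hX := contMDiffAt_extend_tangent u
  have hu := extend_apply_self (EuclideanSpace ℝ (Fin (2 * n + 1))) u
  set X := extend (EuclideanSpace ℝ (Fin (2 * n + 1))) u
  rw [← hu, S.h_apply (hX.mdifferentiableAt (by simp))]
  rw [S.h_apply (X := fun q ↦ S.φ q (X q)) ((S.contMDiffAt_φ hX).mdifferentiableAt (by simp))]
  have h1 : (fun q ↦ S.φ q (S.φ q (X q))) = X + (fun q ↦ - S.η q (X q)) • S.ξ := by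
    ext1 q
    simp [S.φ_φ, sub_eq_add_neg]
  have h2 : MDifferentiableAt (𝓡 (2 * n + 1)) 𝓘(ℝ, ℝ) (fun q ↦ - S.η q (X q)) p :=
    (S.contMDiffAt_η hX).neg.mdifferentiableAt (by simp)
  have h3 : DiffFieldAt S.ξ p := S.contMDiffAt_ξ.mdifferentiableAt (by simp)
  have h4 : mvfderiv (𝓡 (2 * n + 1)) (fun q ↦ - S.η q (X q)) p =
      - mvfderiv (𝓡 (2 * n + 1)) (fun q ↦ S.η q (X q)) p := mvfderiv_neg
  rw [h1, mlieBracket_add_right (hX.mdifferentiableAt (by simp)) (h2.smul_section h3),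
    mlieBracket_smul_right h2 h3, mlieBracket_self, h4]
  rw [map_smul, map_sub, S.φ_φ, S.η_mlieBracket_ξ (hX.mdifferentiableAt (by simp))]
  simp
  module

/-- Put `φX` for `X` in `mvfderiv_val_φ_ξ_eq`: the derivative of `g(φX, φY)` and the two bracket
terms together are symmetric in `X` and `Y`, hence so is the term with `h`. Self-adjointness of `h`
follows by putting `φv` for `v`. -/
lemma val_φ_h (u v : TangentSpace (𝓡 (2 * n + 1)) p) :
    S.g.val p (S.φ p u) (S.h p v) = S.g.val p (S.φ p v) (S.h p u) := by
  have hX := contMDiffAt_extend_tangent u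
  have hY := contMDiffAt_extend_tangent v
  have e1 := S.mvfderiv_val_φ_ξ_eq (S.contMDiffAt_φ hX) hY
  have e2 := S.mvfderiv_val_φ_ξ_eq (S.contMDiffAt_φ hY) hX
  simp only [S.g.symm _ (S.φ _ (extend (EuclideanSpace ℝ (Fin (2 * n + 1))) v _))] at e2
  rw [e1] at e2
  simp only [extend_apply_self] at e2
  rw [S.g.symm p (S.φ p v)]
  rw [S.g.symm p _ (S.φ p u)] at e2
  rw [S.g.symm p _ (S.φ p v)] at e2
  rw [S.g.symm p _ (S.φ p v)] at e2
  rw [S.g.symm p _ (S.φ p v)]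
  linarith

lemma val_h_left (u v : TangentSpace (𝓡 (2 * n + 1)) p) :
    S.g.val p (S.h p u) v = S.g.val p u (S.h p v) := by
  have e := S.val_φ_h u (S.φ p v)
  rw [S.h_φ, map_neg, S.compatible, S.φ_φ, S.η_h] at e
  simp [S.val_ξ, S.η_h] at e
  rw [e, S.g.symm]

/-- The vectors `φw` and `ξ` span the tangent space. Against `φw`, the Koszul formula splits into
the Lie derivative of `g` along `ξ`, which gives `φh`, and a `dη` term, which gives `-φ`. Against
`ξ`, both sides vanish because `g(ξ, ξ) = 1`. -/
lemma leviCivita_ξ (u : TangentSpace (𝓡 (2 * n + 1)) p) :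
    S.g.leviCivita S.ξ p u = - S.φ p u + S.φ p (S.h p u) := by
  have hξ := S.contMDiffAt_ξ (p := p)
  have d1 {X : Π p : M, TangentSpace (𝓡 (2 * n + 1)) p} (hX : SmoothFieldAt X p) :
    DiffFieldAt X p := hX.mdifferentiableAt (by simp)
  have hX := contMDiffAt_extend_tangent u
  have hu := extend_apply_self (EuclideanSpace ℝ (Fin (2 * n + 1))) u
  set X := extend (EuclideanSpace ℝ (Fin (2 * n + 1))) u
  have key (w : TangentSpace (𝓡 (2 * n + 1)) p) :
      S.g.val p (S.g.leviCivita S.ξ p u) (S.φ p w) =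
        S.g.val p (- S.φ p u + S.φ p (S.h p u)) (S.φ p w) := by
    have hY := contMDiffAt_extend_tangent w
    have hw := extend_apply_self (EuclideanSpace ℝ (Fin (2 * n + 1))) w
    set Y := extend (EuclideanSpace ℝ (Fin (2 * n + 1))) w
    have hφY := S.contMDiffAt_φ hY
    have k := S.g.leviCivitaFun_spec (d1 hX) (d1 hξ) (d1 hφY)
    have k1 := S.mvfderiv_val_φ_ξ_eq hX hY
    have k2 := S.η_mlieBracket (d1 hX) (d1 hφY)
    rw [PseudoRiemannianMetric.koszul, k1] at k
    simp only [S.val_ξ, S.val_ξ_right] at k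
    rw [k2, mlieBracket_swap_apply (V := X) (W := S.ξ), S.g.symm p _ (X p)] at k
    rw [hw, hu] at k
    change 2 * S.g.val p (S.g.leviCivita S.ξ p u) (S.φ p w) = _ at k
    rw [map_add, map_neg, add_apply, neg_apply, S.compatible, S.compatible, S.val_h_left, S.η_h]
    rw [S.φ_φ] at k
    simp [S.val_ξ_right] at k
    linarith
  refine S.g.ext_of_apply fun w ↦ ?_
  have hw : w = S.φ p (S.φ p w) + S.η p w • S.ξ p := by rw [S.φ_φ]; abel
  have hξ0 : S.g.val p (S.g.leviCivita S.ξ p u) (S.ξ p) = 0 := by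
    have k := S.g.leviCivita_metric (d1 hX) (d1 hξ) (d1 hξ)
    have hc : (fun q ↦ S.g.val q (S.ξ q) (S.ξ q)) = fun _ ↦ (1 : ℝ) :=
      funext fun q ↦ by rw [S.val_ξ, S.η_ξ]
    rw [hc, mvfderiv_const, S.g.symm p (S.ξ p), hu] at k
    simp at k
    linarith
  have hη0 : S.η p (- S.φ p u + S.φ p (S.h p u)) = 0 := by simp [S.η_φ]
  rw [hw, map_add, map_add, key, map_smul, map_smul, hξ0, S.val_ξ_right, hη0]

end ParacontactMetricStructure

namespace ParacontactMetricStructure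

open VectorField FiberBundle

variable {n : ℕ} {M : Type*} [TopologicalSpace M] [T2Space M]
  [ChartedSpace (EuclideanSpace ℝ (Fin (2 * n + 1))) M] [IsManifold (𝓡 (2 * n + 1)) ∞ M]
  (S : ParacontactMetricStructure n M)
  {X Y Z : Π p : M, TangentSpace (𝓡 (2 * n + 1)) p} {p : M}

/-! ### The Jacobi operator of `ξ` -/

lemma φ_φ_φ (u : TangentSpace (𝓡 (2 * n + 1)) p) : S.φ p (S.φ p (S.φ p u)) = S.φ p u := by
  rw [S.φ_φ, S.η_φ, zero_smul, sub_zero]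

lemma φ_φ_h (u : TangentSpace (𝓡 (2 * n + 1)) p) : S.φ p (S.φ p (S.h p u)) = S.h p u := by
  rw [S.φ_φ, S.η_h, zero_smul, sub_zero]

/-- Anticommutation with `φ` cancels the `h`-part of `∇ξ`; the multiple of `φ` that remains is
parallel along `ξ`. -/
lemma leviCivita_ξ_φ_add (u : TangentSpace (𝓡 (2 * n + 1)) p) :
    S.g.leviCivita S.ξ p u + S.φ p (S.g.leviCivita S.ξ p (S.φ p u)) = - (2 : ℝ) • S.φ p u := by
  rw [S.leviCivita_ξ, S.leviCivita_ξ, S.h_φ]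
  simp only [map_add, map_neg, S.φ_φ_φ, S.φ_φ_h]
  module

lemma leviCivita_ξ_sq (u : TangentSpace (𝓡 (2 * n + 1)) p) :
    S.g.leviCivita S.ξ p (S.g.leviCivita S.ξ p u) = S.φ p (S.φ p u) - S.h p (S.h p u) := by
  have h1 : S.φ p (S.h p (S.φ p (S.h p u))) = - S.h p (S.h p u) := by
    rw [S.h_φ, map_neg, S.φ_φ_h]
  have h2 : S.φ p (S.h p (S.φ p u)) = - S.h p u := by
    rw [S.h_φ, map_neg, S.φ_φ_h]
  simp only [S.leviCivita_ξ, map_add, map_neg, h1, h2, S.φ_φ_h]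
  module

/-- `∇_ξ φ = 0`. -/
lemma leviCivita_φ_ξ (hX : SmoothFieldAt X p) :
    S.g.leviCivita (fun q ↦ S.φ q (X q)) p (S.ξ p) = S.φ p (S.g.leviCivita X p (S.ξ p)) := by
  have hξ : DiffFieldAt S.ξ p := S.contMDiffAt_ξ.mdifferentiableAt (by simp)
  have hd : DiffFieldAt X p := hX.mdifferentiableAt (by simp)
  have h1 := S.g.leviCivita_torsion_free hξ hd
  have h2 := S.g.leviCivita_torsion_free hξ ((S.contMDiffAt_φ hX).mdifferentiableAt (by simp))
  have h3 := S.h_apply hd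
  rw [← h1, ← h2, map_sub] at h3
  simp only [S.leviCivita_ξ, map_add, map_neg, S.h_φ, S.φ_φ, S.η_h] at h3
  -- In `2hX = [ξ, φX] - φ[ξ, X]`, the terms `-∇_{φX} ξ + φ∇_X ξ` already amount to `2hX`, so the
  -- derivatives along `ξ` must cancel.
  have h4 : (2 : ℝ) • S.h p (X p) = (2 : ℝ) • S.h p (X p) +
      (S.g.leviCivita (fun q ↦ S.φ q (X q)) p (S.ξ p) - S.φ p (S.g.leviCivita X p (S.ξ p))) := by
    linear_combination (norm := module) (2 : ℝ) • h3
  rw [left_eq_add, sub_eq_zero] at h4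
  exact h4

lemma contMDiffAt_leviCivita_ξ (hX : SmoothFieldAt X p) :
    SmoothFieldAt (fun q ↦ S.g.leviCivita S.ξ q (X q)) p :=
  S.g.contMDiffAt_leviCivita hX S.contMDiffAt_ξ

/-- `R(X, ξ)ξ = -∇_ξ(∇_X ξ) + ∇_{∇_ξ X} ξ - ∇_{∇_X ξ} ξ`. -/
lemma curvature_ξ_ξ (hX : SmoothFieldAt X p) :
    S.g.curvature X S.ξ S.ξ p = - S.g.leviCivita (fun q ↦ S.g.leviCivita S.ξ q (X q)) p (S.ξ p)
      + S.g.leviCivita S.ξ p (S.g.leviCivita X p (S.ξ p))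
      - S.g.leviCivita S.ξ p (S.g.leviCivita S.ξ p (X p)) := by
  have h1 : (fun q ↦ S.g.leviCivita S.ξ q (S.ξ q)) = 0 := by
    ext1 q
    rw [S.leviCivita_ξ, S.h_ξ, S.φ_ξ]
    simp
  rw [PseudoRiemannianMetric.curvature, h1, CovariantDerivative.zero,
    ← S.g.leviCivita_torsion_free (hX.mdifferentiableAt (by simp))
      (S.contMDiffAt_ξ.mdifferentiableAt (by simp)), map_sub]
  simp
  module

/-- With `A = ∇ξ` and `l = -∇_ξ A - A²`, conjugation by `φ` commutes with `∇_ξ`. As `A + φAφ = -2φ`,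
the derivative part of `l + φlφ` is zero. The rest is `-A² - φA²φ`, where `A² = φ² - h²` and `φA²φ =
A²`. -/
lemma curvature_ξ_ξ_φ (hX : SmoothFieldAt X p) :
    S.g.curvature X S.ξ S.ξ p + S.φ p (S.g.curvature (fun q ↦ S.φ q (X q)) S.ξ S.ξ p) =
      (2 : ℝ) • (S.h p (S.h p (X p)) - S.φ p (S.φ p (X p))) := by
  have hφX := S.contMDiffAt_φ hX
  have hA := S.contMDiffAt_leviCivita_ξ hX
  have hAφ := S.contMDiffAt_leviCivita_ξ hφX
  have e1 := S.leviCivita_φ_ξ hAφ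
  have e2 := S.g.leviCivita.isCovariantDerivativeOnUniv.add
    (hA.mdifferentiableAt (by simp)) ((S.contMDiffAt_φ hAφ).mdifferentiableAt (by simp))
  have e3 : (fun q ↦ S.g.leviCivita S.ξ q (X q)) +
      (fun q ↦ S.φ q (S.g.leviCivita S.ξ q (S.φ q (X q)))) =
      (-(2 : ℝ)) • fun q ↦ S.φ q (X q) := funext fun q ↦ S.leviCivita_ξ_φ_add (X q)
  have e4 := S.g.leviCivita.isCovariantDerivativeOnUniv.smul_const (-(2 : ℝ))
    (hφX.mdifferentiableAt (by simp))
  rw [e3, e4] at e2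
  have e5 := congr($e2 (S.ξ p))
  have e6 := S.leviCivita_ξ_φ_add (S.g.leviCivita X p (S.ξ p))
  have e7 := S.leviCivita_φ_ξ hX
  rw [S.curvature_ξ_ξ hX, S.curvature_ξ_ξ hφX, e7, S.leviCivita_ξ_sq, S.leviCivita_ξ_sq]
  change (-(2 : ℝ)) • S.g.leviCivita (fun q ↦ S.φ q (X q)) p (S.ξ p) =
    S.g.leviCivita (fun q ↦ S.g.leviCivita S.ξ q (X q)) p (S.ξ p) +
    S.g.leviCivita (fun q ↦ S.φ q (S.g.leviCivita S.ξ q (S.φ q (X q)))) p (S.ξ p) at e5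
  rw [e1, e7] at e5
  have e8 : S.φ p (S.φ p (S.φ p (S.φ p (X p))) - S.h p (S.h p (S.φ p (X p)))) =
      S.φ p (S.φ p (X p)) - S.h p (S.h p (X p)) := by
    rw [S.φ_φ_φ, S.h_φ, map_neg, S.h_φ, neg_neg, map_sub, S.φ_φ_h]
  rw [map_sub, map_add, map_neg, e8]
  linear_combination (norm := module) e5 + e6

lemma curvature_add_smul (hX : SmoothFieldAt X p) (hY : SmoothFieldAt Y p) (t : ℝ) :
    S.g.curvature (X + t • Y) S.ξ S.ξ p =
      S.g.curvature X S.ξ S.ξ p + t • S.g.curvature Y S.ξ S.ξ p := by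
  have htY : SmoothFieldAt (t • Y) p := hY.const_smul_section
  have hXY : SmoothFieldAt (X + t • Y) p := hX.add_section htY
  have c {X Y : Π p : M, TangentSpace (𝓡 (2 * n + 1)) p} (hX : SmoothFieldAt X p)
      (hY : SmoothFieldAt Y p) : S.g.leviCivita (X + t • Y) p =
        S.g.leviCivita X p + t • S.g.leviCivita Y p := by
    have h1 := S.g.leviCivita.isCovariantDerivativeOnUniv.add (hX.mdifferentiableAt (by simp))
      ((hY.const_smul_section (a := t)).mdifferentiableAt (by simp))
    have h2 := S.g.leviCivita.isCovariantDerivativeOnUniv.smul_const t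
      (hY.mdifferentiableAt (by simp))
    exact h1.trans congr(_ + $h2)
  have e1 : (fun q ↦ S.g.leviCivita S.ξ q ((X + t • Y) q)) =
      (fun q ↦ S.g.leviCivita S.ξ q (X q)) + t • fun q ↦ S.g.leviCivita S.ξ q (Y q) := by
    ext1 q
    simp
  rw [S.curvature_ξ_ξ hXY, S.curvature_ξ_ξ hX, S.curvature_ξ_ξ hY, e1, c hX hY,
    c (S.contMDiffAt_leviCivita_ξ hX) (S.contMDiffAt_leviCivita_ξ hY)]
  simp
  module

/-- If `(a + b t + c t²)(d + e t + f t²)` vanishes identically and `f ≠ 0`, then `a = 0`. -/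
lemma _root_.eq_zero_of_forall_quadratic_mul {a b c d e f : ℝ} (hf : f ≠ 0)
    (h : ∀ t : ℝ, d + e * t + f * t ^ 2 ≠ 0 → a + b * t + c * t ^ 2 = 0) : a = 0 := by
  open Polynomial in
  let P : ℝ[X] := C a + C b * X + C c * X ^ 2
  let Q : ℝ[X] := C d + C e * X + C f * X ^ 2
  have hPQ : P * Q = 0 := Polynomial.funext fun t ↦ by
    by_cases ht : d + e * t + f * t ^ 2 = 0
    · simp [P, Q, ht]
    · simp [P, Q, h t ht]
  rcases mul_eq_zero.1 hPQ with hP | hQ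
  · simpa [P] using congr(Polynomial.eval 0 $hP)
  · have := congr(Polynomial.coeff $hQ 2)
    simp [Q] at this
    exact absurd this hf

section

variable (hK : ∀ (p : M) (u : TangentSpace (𝓡 (2 * n + 1)) p),
  S.g.IsNondegeneratePlane p u (S.ξ p) → S.g.sectionalCurvature p u (S.ξ p) = 0)

include hK in
lemma val_curvature_ξ_eq_zero (hX : SmoothFieldAt X p)
    (hN : S.g.val p (X p) (X p) - S.η p (X p) ^ 2 ≠ 0) :
    S.g.val p (S.g.curvature X S.ξ S.ξ p) (X p) = 0 := by
  have hnd : S.g.IsNondegeneratePlane p (X p) (S.ξ p) := by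
    rw [PseudoRiemannianMetric.IsNondegeneratePlane, S.val_ξ_right, S.val_ξ_right, S.η_ξ,
      mul_one]
    exact hN
  have h := hK p (X p) hnd
  rw [PseudoRiemannianMetric.sectionalCurvature, div_eq_zero_iff, or_iff_left hnd] at h
  rwa [S.g.curvatureTensor_eq hX S.contMDiffAt_ξ S.contMDiffAt_ξ] at h

include hK in
-- The hypothesis is silent when `X` and `ξ` span a degenerate plane. Replace `X` by `X + tW`:
-- nondegeneracy becomes the nonvanishing of a quadratic in `t` with leading coefficient `g(w, w) -
-- η(w)² ≠ 0`. So the quadratic `g(R(X + tW, ξ)ξ, X + tW)` vanishes for all but finitely many `t`,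
-- hence also at `t = 0`.
lemma val_curvature_ξ_eq_zero' {w : TangentSpace (𝓡 (2 * n + 1)) p}
    (hw : S.g.val p w w - S.η p w ^ 2 ≠ 0) (hX : SmoothFieldAt X p) :
    S.g.val p (S.g.curvature X S.ξ S.ξ p) (X p) = 0 := by
  have hW := contMDiffAt_extend_tangent w
  have hw' := extend_apply_self (EuclideanSpace ℝ (Fin (2 * n + 1))) w
  set W := extend (EuclideanSpace ℝ (Fin (2 * n + 1))) w
  have hsymm := S.g.symm p (X p) w
  refine eq_zero_of_forall_quadratic_mul
    (b := S.g.val p (S.g.curvature X S.ξ S.ξ p) w + S.g.val p (S.g.curvature W S.ξ S.ξ p) (X p))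
    (c := S.g.val p (S.g.curvature W S.ξ S.ξ p) w)
    (d := S.g.val p (X p) (X p) - S.η p (X p) ^ 2)
    (e := 2 * S.g.val p (X p) w - 2 * S.η p (X p) * S.η p w) hw fun t ht ↦ ?_
  have hXW : SmoothFieldAt (X + t • W) p := hX.add_section hW.const_smul_section
  have h := S.val_curvature_ξ_eq_zero hK hXW ?_
  · rw [S.curvature_add_smul hX hW] at h
    simp [hw'] at h
    linarith
  · refine ne_of_eq_of_ne ?_ ht
    simp [hw', hsymm]
    ring

include hK in
/-- `h² = φ²` if the sectional curvatures of the planes containing `ξ` vanish. -/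
lemma h_h (u : TangentSpace (𝓡 (2 * n + 1)) p) : S.h p (S.h p u) = S.φ p (S.φ p u) := by
  by_cases hN : ∃ w : TangentSpace (𝓡 (2 * n + 1)) p, S.g.val p w w - S.η p w ^ 2 ≠ 0
  · obtain ⟨w, hw⟩ := hN
    let B (u : TangentSpace (𝓡 (2 * n + 1)) p) := S.h p (S.h p u) - S.φ p (S.φ p u)
    have hB (u v) : S.g.val p (B u) v = S.g.val p (B v) u := by
      have a1 : S.g.val p (S.h p (S.h p u)) v = S.g.val p (S.h p (S.h p v)) u := by
        rw [S.val_h_left, S.g.symm p _ (S.h p v), S.val_h_left (S.h p v)]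
      have a2 : S.g.val p (S.φ p (S.φ p u)) v = S.g.val p (S.φ p (S.φ p v)) u := by
        rw [S.val_φ_left, S.g.symm p _ (S.φ p v), S.val_φ_left (S.φ p v)]
      simp only [B, map_sub, sub_apply, a1, a2]
    have hq (u) : S.g.val p (B u) u = 0 := by
      have hX := contMDiffAt_extend_tangent u
      have hu := extend_apply_self (EuclideanSpace ℝ (Fin (2 * n + 1))) u
      set X := extend (EuclideanSpace ℝ (Fin (2 * n + 1))) u
      have h1 := S.val_curvature_ξ_eq_zero' hK hw hX
      have h2 := S.val_curvature_ξ_eq_zero' hK hw (S.contMDiffAt_φ hX)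
      -- As `φ` is skew, pairing with `X` turns the second curvature term into `-g(R(φX, ξ)ξ, φX)`.
      have h3 := congr(S.g.val p $(S.curvature_ξ_ξ_φ hX) (X p))
      rw [map_add, add_apply, S.val_φ_left, h1, h2, hu] at h3
      simpa [B] using h3.symm
    -- Polarization: `B` is self-adjoint with zero quadratic form.
    refine sub_eq_zero.1 (S.g.nondegenerate p (B u) fun v ↦ ?_)
    have h1 := hq (u + v)
    have hadd : B (u + v) = B u + B v := by simp [B]; abel
    rw [hadd] at h1
    simp [hq, hB v u] at h1
    linarith
  -- Here `g(φu, φu) = 0` for all `u`. Polarization forces `φ = 0`, so `ξ` spans the tangent space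
  -- and both sides vanish.
  · push Not at hN
    have hφ (u : TangentSpace (𝓡 (2 * n + 1)) p) : S.φ p u = 0 := by
      have hφ1 (u) : S.g.val p (S.φ p u) (S.φ p u) = 0 := by
        rw [S.compatible]; linarith [hN u]
      refine S.g.nondegenerate p _ fun v ↦ ?_
      have h1 := hφ1 (u + S.φ p v)
      have h2 := S.compatible p u (S.φ p v)
      have h3 := S.val_φ_left u v
      have h4 := hφ1 v
      simp only [map_add, add_apply, hφ1] at h1
      rw [S.g.symm p (S.φ p (S.φ p v)), h2, S.η_φ] at h1
      rw [h3]
      linarith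
    have hu : u = S.η p u • S.ξ p := by
      have := S.φ_φ p u
      rw [hφ] at this
      exact (sub_eq_zero.1 this.symm)
    rw [hφ, hu, map_smul, S.h_ξ]
    simp

end

end ParacontactMetricStructure

namespace ParacontactMetricStructure

open VectorField FiberBundle

variable {n : ℕ} {M : Type*} [TopologicalSpace M] [T2Space M]
  [ChartedSpace (EuclideanSpace ℝ (Fin (2 * n + 1))) M] [IsManifold (𝓡 (2 * n + 1)) ∞ M]
  (S : ParacontactMetricStructure n M)
  {X Y Z : Π p : M, TangentSpace (𝓡 (2 * n + 1)) p} {p : M}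

/-! ### The eigenspaces of `h` -/

lemma mem_hEigenspace {c : ℝ} {u : TangentSpace (𝓡 (2 * n + 1)) p} :
    u ∈ S.hEigenspace p c ↔ S.h p u = c • u :=
  Module.End.mem_eigenspace_iff

lemma mem_hEigenspace_one {u : TangentSpace (𝓡 (2 * n + 1)) p} :
    u ∈ S.hEigenspace p 1 ↔ S.h p u = u := by
  rw [S.mem_hEigenspace, one_smul]

lemma mem_distribution {u : TangentSpace (𝓡 (2 * n + 1)) p} :
    u ∈ S.distribution p ↔ S.η p u = 0 := Iff.rfl

lemma hEigenspace_le_distribution {c : ℝ} (hc : c ≠ 0) :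
    S.hEigenspace p c ≤ S.distribution p := fun u hu ↦ by
  have h := congr(S.η p $(S.mem_hEigenspace.1 hu))
  rw [S.η_h, map_smul, smul_eq_mul, eq_comm, mul_eq_zero, or_iff_right hc] at h
  exact h

lemma disjoint_hEigenspace : Disjoint (S.hEigenspace p 1) (S.hEigenspace p (-1)) := by
  refine Submodule.disjoint_def.2 fun u h1 h2 ↦ ?_
  rw [S.mem_hEigenspace_one] at h1
  rw [S.mem_hEigenspace, h1, neg_smul, one_smul] at h2
  have h3 : (2 : ℝ) • u = 0 := by rw [two_smul]; nth_rw 1 [h2]; exact neg_add_cancel u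
  exact (smul_eq_zero.1 h3).resolve_left two_ne_zero

lemma finrank_distribution : Module.finrank ℝ (S.distribution p) = 2 * n := by
  have hd : Module.finrank ℝ (TangentSpace (𝓡 (2 * n + 1)) p) = 2 * n + 1 :=
    finrank_euclideanSpace_fin (𝕜 := ℝ)
  have : FiniteDimensional ℝ (TangentSpace (𝓡 (2 * n + 1)) p) :=
    inferInstanceAs (FiniteDimensional ℝ (EuclideanSpace ℝ (Fin (2 * n + 1))))
  have h := Module.Dual.finrank_ker_add_one_of_ne_zero (f := (S.η p).toLinearMap)
    fun h ↦ by simpa [S.η_ξ] using congr($h (S.ξ p))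
  change Module.finrank ℝ (LinearMap.ker (S.η p).toLinearMap) = 2 * n
  omega

lemma leviCivita_ξ_of_mem {u : TangentSpace (𝓡 (2 * n + 1)) p} (hu : u ∈ S.hEigenspace p 1) :
    S.g.leviCivita S.ξ p u = 0 := by
  rw [S.leviCivita_ξ, S.mem_hEigenspace_one.1 hu, neg_add_cancel]

section

variable (hK : ∀ (p : M) (u : TangentSpace (𝓡 (2 * n + 1)) p),
  S.g.IsNondegeneratePlane p u (S.ξ p) → S.g.sectionalCurvature p u (S.ξ p) = 0)

include hK

lemma h_h_of_mem {u : TangentSpace (𝓡 (2 * n + 1)) p} (hu : u ∈ S.distribution p) :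
    S.h p (S.h p u) = u := by
  rw [S.h_h hK, S.φ_φ, S.mem_distribution.1 hu, zero_smul, sub_zero]

lemma range_h : LinearMap.range (S.h p).toLinearMap = S.distribution p := by
  ext u
  constructor
  · rintro ⟨v, rfl⟩
    exact S.η_h v
  · exact fun hu ↦ ⟨S.h p u, S.h_h_of_mem hK hu⟩

lemma sup_hEigenspace :
    S.hEigenspace p 1 ⊔ S.hEigenspace p (-1) = S.distribution p := by
  refine le_antisymm (sup_le (S.hEigenspace_le_distribution one_ne_zero)
    (S.hEigenspace_le_distribution (by simp))) fun u hu ↦ ?_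
  -- The eigencomponents of `u` under the involution `h` of `ker η`.
  refine Submodule.mem_sup.2 ⟨(1 / 2 : ℝ) • (u + S.h p u), ?_, (1 / 2 : ℝ) • (u - S.h p u), ?_, ?_⟩
  · rw [S.mem_hEigenspace_one, map_smul, map_add, S.h_h_of_mem hK hu, add_comm u]
  · rw [S.mem_hEigenspace, map_smul, map_sub, S.h_h_of_mem hK hu]
    module
  · module

/-- Because `φ` anticommutes with `h` and is injective on `ker η`, it embeds `[+1]` and `[-1]` into
each other. Their dimensions are thus equal and add up to `2n`. -/
lemma finrank_hEigenspace_one : Module.finrank ℝ (S.hEigenspace p 1) = n := by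
  have : FiniteDimensional ℝ (TangentSpace (𝓡 (2 * n + 1)) p) :=
    inferInstanceAs (FiniteDimensional ℝ (EuclideanSpace ℝ (Fin (2 * n + 1))))
  have h1 := Submodule.finrank_sup_add_finrank_inf_eq (S.hEigenspace p 1) (S.hEigenspace p (-1))
  rw [S.sup_hEigenspace hK, S.disjoint_hEigenspace.eq_bot, finrank_bot,
    S.finrank_distribution] at h1
  have key (c : ℝ) (hc : c ≠ 0) : Module.finrank ℝ (S.hEigenspace p c) ≤
      Module.finrank ℝ (S.hEigenspace p (-c)) := by
    have hφ (u) (hu : u ∈ S.hEigenspace p c) : S.φ p u ∈ S.hEigenspace p (-c) := by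
      rw [S.mem_hEigenspace, S.h_φ, S.mem_hEigenspace.1 hu, map_smul, neg_smul]
    refine LinearMap.finrank_le_finrank_of_injective
      (f := (S.φ p).toLinearMap.restrict hφ) fun u v huv ↦ Subtype.ext ?_
    have h2 : S.φ p u = S.φ p v := congr(($huv : TangentSpace (𝓡 (2 * n + 1)) p))
    have h3 := S.hEigenspace_le_distribution hc u.2
    have h4 := S.hEigenspace_le_distribution hc v.2
    have h5 := congr(S.φ p $h2)
    rwa [S.φ_φ, S.φ_φ, S.mem_distribution.1 h3, S.mem_distribution.1 h4, zero_smul, sub_zero,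
      sub_zero] at h5
  have h2 := key 1 one_ne_zero
  have h3 := key (-1) (by simp)
  rw [neg_neg] at h3
  omega

/-- The distribution `[+1]` is involutive if `R(X, Y)ξ` vanishes for `X`, `Y` in `[+1]`. -/
lemma mlieBracket_mem_hEigenspace
    (hR : ∀ u ∈ S.hEigenspace p 1, ∀ v ∈ S.hEigenspace p 1,
      S.g.curvatureTensor p u v (S.ξ p) = 0)
    (hX : SmoothFieldAt X p) (hY : SmoothFieldAt Y p)
    (hX' : ∀ᶠ q in 𝓝 p, X q ∈ S.hEigenspace q 1) (hY' : ∀ᶠ q in 𝓝 p, Y q ∈ S.hEigenspace q 1) :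
    mlieBracket (𝓡 (2 * n + 1)) X Y p ∈ S.hEigenspace p 1 := by
  have hXp := hX'.self_of_nhds
  have hYp := hY'.self_of_nhds
  have hηX : (fun q ↦ S.η q (X q)) =ᶠ[𝓝 p] fun _ ↦ 0 := by
    filter_upwards [hX'] with q hq using S.hEigenspace_le_distribution one_ne_zero hq
  have hηY : (fun q ↦ S.η q (Y q)) =ᶠ[𝓝 p] fun _ ↦ 0 := by
    filter_upwards [hY'] with q hq using S.hEigenspace_le_distribution one_ne_zero hq
  -- `g(X, φY) = g(hX, φY) = g(X, hφY) = -g(X, φhY) = -g(X, φY)`.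
  have hφ : S.g.val p (X p) (S.φ p (Y p)) = 0 := by
    have h1 := S.val_h_left (X p) (S.φ p (Y p))
    rw [S.mem_hEigenspace_one.1 hXp, S.h_φ, S.mem_hEigenspace_one.1 hYp, map_neg] at h1
    linarith
  have hη : S.η p (mlieBracket (𝓡 (2 * n + 1)) X Y p) = 0 := by
    rw [S.η_mlieBracket (hX.mdifferentiableAt (by simp)) (hY.mdifferentiableAt (by simp)),
      hηX.mvfderiv_eq, hηY.mvfderiv_eq, hφ, mvfderiv_const]
    simp
  have h0 {Z : Π p : M, TangentSpace (𝓡 (2 * n + 1)) p} (hZ : SmoothFieldAt Z p)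
      (hZ' : ∀ᶠ q in 𝓝 p, Z q ∈ S.hEigenspace q 1) :
      S.g.leviCivita (fun q ↦ S.g.leviCivita S.ξ q (Z q)) p = 0 := by
    have h1 : ∀ᶠ q in 𝓝 p, (0 : Π p : M, TangentSpace (𝓡 (2 * n + 1)) p) q =
        S.g.leviCivita S.ξ q (Z q) := by
      filter_upwards [hZ'] with q hq using (S.leviCivita_ξ_of_mem hq).symm
    have h2 := S.contMDiffAt_leviCivita_ξ hZ
    have h3 : SmoothFieldAt (0 : Π p : M, TangentSpace (𝓡 (2 * n + 1)) p) p :=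
      h2.congr_of_eventuallyEq (h1.mono fun q hq ↦ congr(Bundle.TotalSpace.mk q $hq))
    exact (S.g.leviCivita_congr h3 h2 h1).symm.trans (congrFun S.g.leviCivita.zero p)
  -- `∇_X ξ` and `∇_Y ξ` vanish near `p`, so only `-∇_{[X,Y]} ξ` survives in `R(X, Y)ξ`.
  have h1 := S.g.curvatureTensor_eq hX hY S.contMDiffAt_ξ
  rw [hR _ hXp _ hYp, PseudoRiemannianMetric.curvature, h0 hX hX', h0 hY hY'] at h1
  simp only [zero_apply, sub_zero, zero_sub, zero_eq_neg] at h1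
  rw [S.leviCivita_ξ] at h1
  -- Now `φ[X, Y] = φh[X, Y]`, and `φ` can be cancelled since `η` vanishes on both vectors.
  have h2 := congr(S.φ p $h1)
  rw [map_add, map_neg, S.φ_φ_h, S.φ_φ, hη, map_zero, zero_smul, sub_zero, neg_add_eq_zero] at h2
  exact S.mem_hEigenspace_one.2 h2.symm

end

end ParacontactMetricStructure

/-! ### Local inverses of smooth maps -/

section

variable {E F : Type*} [NormedAddCommGroup E] [NormedSpace ℝ E] [CompleteSpace E]
  [NormedAddCommGroup F] [NormedSpace ℝ F]

/-- A smooth map with invertible derivative at `a` is near `a` a diffeomorphism. -/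
lemma ContDiffOn.exists_openPartialHomeomorph {f : E → F} {U : Set E} (hf : ContDiffOn ℝ ∞ f U)
    (hU : IsOpen U) {a : E} (ha : a ∈ U) {f' : E ≃L[ℝ] F} (hf' : HasFDerivAt f (f' : E →L[ℝ] F) a) :
    ∃ e : OpenPartialHomeomorph E F, a ∈ e.source ∧ e.source ⊆ U ∧ ⇑e = f ∧
      ContDiffOn ℝ ∞ e.symm e.target ∧ ∀ x ∈ e.source, (fderiv ℝ f x).IsInvertible := by
  have hfa : ContDiffAt ℝ ∞ f a := hf.contDiffAt (hU.mem_nhds ha)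
  have hc : ContDiffOn ℝ ∞ (fderiv ℝ f) U := hf.fderiv_of_isOpen hU (by simp)
  have hinv : ∀ᶠ x in 𝓝 a, (fderiv ℝ f x).IsInvertible := by
    refine (hc.continuousOn.continuousAt (hU.mem_nhds ha)).eventually ?_
    rw [hf'.fderiv]
    exact ContinuousLinearEquiv.nhds f'
  -- Shrinking to where the derivative stays invertible makes the inverse smooth on the whole
  -- target, not only at `f a`.
  obtain ⟨V, hVsub, hVo, haV⟩ := mem_nhds_iff.1 (Filter.inter_mem (hU.mem_nhds ha) hinv)
  have h0 : (∞ : ℕ∞ω) ≠ 0 := by simp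
  let e₀ := hfa.toOpenPartialHomeomorph f hf' h0
  have hcoe : ⇑e₀ = f := rfl
  refine ⟨e₀.restrOpen V hVo, ⟨hfa.mem_toOpenPartialHomeomorph_source hf' h0, haV⟩,
    fun x hx ↦ (hVsub hx.2).1, hcoe, fun y hy ↦ ?_, fun x hx ↦ (hVsub hx.2).2⟩
  have hx := (e₀.restrOpen V hVo).map_target hy
  obtain ⟨g, hg⟩ := (hVsub hx.2).2
  have hxU := hU.mem_nhds (hVsub hx.2).1
  refine ((e₀.restrOpen V hVo).contDiffAt_symm hy (f₀' := g) ?_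
    (hf.contDiffAt hxU)).contDiffWithinAt
  rw [hg]
  exact ((hf.contDiffAt hxU).differentiableAt (by simp)).hasFDerivAt

end

/-! ### Composition and integration as operators on continuous maps -/

namespace ContinuousMap

section

variable (K : Type*) [TopologicalSpace K] [CompactSpace K]
  {E F : Type u} [NormedAddCommGroup E] [NormedSpace ℝ E]
  [NormedAddCommGroup F] [NormedSpace ℝ F]

noncomputable instance : NormedAddCommGroup C(K, E →L[ℝ] F) :=
  ContinuousMap.instNormedAddCommGroup

noncomputable instance : SeminormedAddCommGroup C(K, E →L[ℝ] F) :=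
  NormedAddCommGroup.toSeminormedAddCommGroup

noncomputable instance : AddCommGroup C(K, E →L[ℝ] F) :=
  NormedAddCommGroup.toAddCommGroup

noncomputable instance : AddCommMonoid C(K, E →L[ℝ] F) :=
  ContinuousMap.instAddCommMonoidOfContinuousAdd

noncomputable instance : NormedSpace ℝ C(K, E →L[ℝ] F) :=
  ContinuousMap.normedSpace

noncomputable instance : Module ℝ C(K, E →L[ℝ] F) :=
  NormedSpace.toModule

noncomputable instance : NormedAddCommGroup (C(K, E) →L[ℝ] C(K, F)) :=
  ContinuousLinearMap.toNormedAddCommGroup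

lemma norm_clm_apply_le (A : C(K, E →L[ℝ] F)) (x : C(K, E)) :
    ‖(⟨fun t ↦ A t (x t), by fun_prop⟩ : C(K, F))‖ ≤ ‖A‖ * ‖x‖ := by
  refine (ContinuousMap.norm_le _ (by positivity)).2 fun t ↦ ?_
  exact ((A t).le_of_opNorm_le (A.norm_coe_le_norm t) (x t)).trans (by
    gcongr; exact x.norm_coe_le_norm t)

/-- Pointwise application of a field of linear maps. -/
noncomputable def clmApplyAux (A : C(K, E →L[ℝ] F)) : C(K, E) →L[ℝ] C(K, F) :=
  LinearMap.mkContinuous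
    { toFun x := ⟨fun t ↦ A t (x t), by fun_prop⟩
      map_add' _ _ := by ext; simp
      map_smul' _ _ := by ext; simp } ‖A‖ (norm_clm_apply_le K A)

/-- Pointwise application of linear maps to vectors. -/
noncomputable def clmApply : C(K, E →L[ℝ] F) →L[ℝ] C(K, E) →L[ℝ] C(K, F) :=
  LinearMap.mkContinuous
    { toFun := clmApplyAux K
      map_add' _ _ := rfl
      map_smul' _ _ := rfl } 1 fun A ↦ by
    rw [one_mul]
    exact LinearMap.mkContinuous_norm_le _ (norm_nonneg A) (norm_clm_apply_le K A)

@[simp] lemma clmApply_apply (A : C(K, E →L[ℝ] F)) (x : C(K, E)) (t : K) :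
    clmApply K A x t = A t (x t) := rfl

variable {K}

section

variable {G : Type*} [NormedAddCommGroup G] [NormedSpace ℝ G] {A : G → C(K, E →L[ℝ] F)}
  {x : G → C(K, E)}

lemma isBoundedBilinearMap_clmApply :
    IsBoundedBilinearMap ℝ fun p : C(K, E →L[ℝ] F) × C(K, E) ↦ clmApply K p.1 p.2 where
  add_left _ _ _ := by ext; simp
  smul_left _ _ _ := by ext; simp
  add_right _ _ _ := by simp
  smul_right _ _ _ := by simp
  bound := ⟨1, one_pos, fun A x ↦ by rw [one_mul]; exact norm_clm_apply_le K A x⟩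

lemma contDiff_clmApply {k : ℕ∞ω} (hA : ContDiff ℝ k A) (hx : ContDiff ℝ k x) :
    ContDiff ℝ k fun q ↦ clmApply K (A q) (x q) := by
  have hb := isBoundedBilinearMap_clmApply (K := K) (E := E) (F := F)
  exact hb.contDiff.comp (hA.prodMk hx)

lemma fderiv_clmApply {q : G} (hA : DifferentiableAt ℝ A q) (hx : DifferentiableAt ℝ x q) (w : G) :
    fderiv ℝ (fun q ↦ clmApply K (A q) (x q)) q w =
      clmApply K (fderiv ℝ A q w) (x q) + clmApply K (A q) (fderiv ℝ x q w) := by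
  have hb := isBoundedBilinearMap_clmApply (K := K) (E := E) (F := F)
  have h : HasFDerivAt (fun q ↦ clmApply K (A q) (x q)) _ q :=
    HasFDerivAt.comp (g := fun p : C(K, E →L[ℝ] F) × C(K, E) ↦ clmApply K p.1 p.2) q
      (hb.hasFDerivAt (A q, x q)) (hA.hasFDerivAt.prodMk hx.hasFDerivAt)
  rw [h.fderiv, add_comm]
  rfl

end

/-- The range of `z` is compact, so `fderiv ℝ f` is uniformly continuous along it, and the mean
value inequality bounds the remainder uniformly in `t`. -/
lemma hasFDerivAt_comp {f : E → F} (hf : ContDiff ℝ 1 f) (z : C(K, E)) :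
    HasFDerivAt (fun z : C(K, E) ↦ (⟨f, hf.continuous⟩ : C(E, F)).comp z)
      (clmApply K ((⟨fderiv ℝ f, hf.continuous_fderiv (by simp)⟩ : C(E, E →L[ℝ] F)).comp z)) z := by
  refine .of_isLittleO (Asymptotics.isLittleO_iff.2 fun ε hε ↦ ?_)
  have hu := (isCompact_range z.continuous).uniformContinuousAt_of_continuousAt (fderiv ℝ f)
    (fun x _ ↦ (hf.continuous_fderiv (by simp)).continuousAt) (Metric.dist_mem_uniformity hε)
  obtain ⟨δ, hδ, hu⟩ := Metric.mem_uniformity_dist.1 hu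
  filter_upwards [Metric.ball_mem_nhds z hδ] with w hw
  refine (ContinuousMap.norm_le _ (by positivity)).2 fun t ↦ ?_
  have hwt : w t ∈ Metric.ball (z t) δ :=
    (ContinuousMap.dist_apply_le_dist t).trans_lt hw
  have h := (convex_ball (z t) δ).norm_image_sub_le_of_norm_fderiv_le' (𝕜 := ℝ) (f := f)
    (φ := fderiv ℝ f (z t)) (C := ε) (fun x _ ↦ hf.differentiable (by simp) x) (fun x hx ↦ ?_)
    (Metric.mem_ball_self hδ) hwt
  · refine h.trans ?_
    gcongr
    exact (w - z).norm_coe_le_norm t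
  · have := hu (a := z t) (b := x) (by rw [dist_comm]; exact hx) ⟨t, rfl⟩
    rw [← dist_eq_norm, dist_comm]
    exact this.le

/-- The derivative of `z ↦ f ∘ z` is `clmApply` of `z ↦ Df ∘ z`, an operator of the same kind with
one derivative less. The target changes to `E →L[ℝ] F`, so `F` varies in the induction and shares a
universe with `E`. -/
lemma contDiff_comp_nat (k : ℕ) : ∀ {F : Type u} [NormedAddCommGroup F] [NormedSpace ℝ F]
    {f : E → F} (_ : ContDiff ℝ k f) (hc : Continuous f),
    ContDiff ℝ k (fun z : C(K, E) ↦ (⟨f, hc⟩ : C(E, F)).comp z) := by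
  induction k with
  | zero =>
    intro F _ _ f _ hc
    exact contDiff_zero.2 (ContinuousMap.continuous_postcomp _)
  | succ k ih =>
    intro F _ _ f hf hc
    refine contDiff_succ_iff_hasFDerivAt.2 ⟨_, ?_, fun z ↦
      hasFDerivAt_comp (hf.of_le (by simp)) z⟩
    exact (clmApply K).contDiff.comp (ih (hf.fderiv_right (by simp)) _)

lemma contDiff_comp {f : E → F} (hf : ContDiff ℝ ∞ f) :
    ContDiff ℝ ∞ (fun z : C(K, E) ↦ (⟨f, hf.continuous⟩ : C(E, F)).comp z) :=
  contDiff_infty.2 fun k ↦ contDiff_comp_nat k (contDiff_infty.1 hf k) _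

end

section

variable {E : Type*} [NormedAddCommGroup E] [NormedSpace ℝ E]

/-- The primitive that vanishes at `0` of a continuous map on the unit interval. -/
noncomputable def primitive : C(unitInterval, E) →L[ℝ] C(unitInterval, E) :=
  LinearMap.mkContinuous
    { toFun z := ⟨fun t ↦ ∫ s in (0 : ℝ)..t, Set.IccExtend zero_le_one z s,
        (intervalIntegral.continuous_primitive
          (fun _ _ ↦ z.continuous.Icc_extend'.intervalIntegrable _ _) 0).comp continuous_subtype_val⟩
      map_add' z w := by
        ext t
        exact intervalIntegral.integral_add (z.continuous.Icc_extend'.intervalIntegrable _ _)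
          (w.continuous.Icc_extend'.intervalIntegrable _ _)
      map_smul' c z := by
        ext t
        exact intervalIntegral.integral_smul c _ } 1 fun z ↦ by
    refine (ContinuousMap.norm_le _ (by positivity)).2 fun t ↦ ?_
    refine (intervalIntegral.norm_integral_le_of_norm_le_const
      (fun s _ ↦ z.norm_coe_le_norm _)).trans ?_
    rw [sub_zero, abs_of_nonneg t.2.1, one_mul]
    exact mul_le_of_le_one_right (norm_nonneg z) t.2.2

lemma primitive_apply (z : C(unitInterval, E)) (t : unitInterval) :
    primitive z t = ∫ s in (0 : ℝ)..t, Set.IccExtend zero_le_one z s := rfl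

end

end ContinuousMap

/-! ### The equation `z(t) = y + ∫₀ᵗ B(z(s)) x ds` -/

namespace RadialODE

open ContinuousMap unitInterval

variable {E : Type u} [NormedAddCommGroup E] [NormedSpace ℝ E]
  {B : E → E →L[ℝ] E} (hB : ContDiff ℝ ∞ B)

/-- The defect of `z` as a solution of `z(t) = y + ∫₀ᵗ B(z(s)) x ds`. -/
noncomputable def defect (q : (E × E) × C(I, E)) : C(I, E) :=
  q.2 - .const I q.1.2 -
    primitive (clmApply I ((⟨B, hB.continuous⟩ : C(E, E →L[ℝ] E)).comp q.2) (.const I q.1.1))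

lemma contDiff_const_apply {G : Type*} [NormedAddCommGroup G] [NormedSpace ℝ G] (l : G →L[ℝ] E) :
    ContDiff ℝ ∞ fun q ↦ ContinuousMap.const I (l q) :=
  (ContinuousLinearMap.const ℝ (M := E) I ∘L l).contDiff

lemma fderiv_const_apply {G : Type*} [NormedAddCommGroup G] [NormedSpace ℝ G] (l : G →L[ℝ] E)
    (q w : G) : fderiv ℝ (fun q ↦ ContinuousMap.const I (l q)) q w = .const I (l w) :=
  congr($((ContinuousLinearMap.const ℝ (M := E) I ∘L l).hasFDerivAt.fderiv) w)

lemma contDiff_nemytskii : ContDiff ℝ ∞ fun q : (E × E) × C(I, E) ↦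
    (⟨B, hB.continuous⟩ : C(E, E →L[ℝ] E)).comp q.2 :=
  (contDiff_comp hB).comp contDiff_snd

lemma contDiff_primitive_clmApply : ContDiff ℝ ∞ fun q : (E × E) × C(I, E) ↦
    clmApply I ((⟨B, hB.continuous⟩ : C(E, E →L[ℝ] E)).comp q.2) (.const I q.1.1) :=
  contDiff_clmApply (contDiff_nemytskii hB)
    (contDiff_const_apply (.fst ℝ E E ∘L .fst ℝ (E × E) C(I, E)))

lemma contDiff_defect : ContDiff ℝ ∞ (defect hB) :=
  (contDiff_snd.sub (contDiff_const_apply (.snd ℝ E E ∘L .fst ℝ (E × E) C(I, E)))).sub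
    ((primitive (E := E)).contDiff.comp (contDiff_primitive_clmApply hB))

lemma fderiv_defect (q w : (E × E) × C(I, E)) :
    fderiv ℝ (defect hB) q w = w.2 - .const I w.1.2 - primitive
      (clmApply I (clmApply I ((⟨fderiv ℝ B, hB.continuous_fderiv (by simp)⟩ :
        C(E, E →L[ℝ] E →L[ℝ] E)).comp q.2) w.2) (.const I q.1.1) +
      clmApply I ((⟨B, hB.continuous⟩ : C(E, E →L[ℝ] E)).comp q.2) (.const I w.1.1)) := by
  have c1 := contDiff_const_apply (.fst ℝ E E ∘L .fst ℝ (E × E) C(I, E))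
  have c2 := contDiff_const_apply (.snd ℝ E E ∘L .fst ℝ (E × E) C(I, E))
  have d1 := fderiv_const_apply (.fst ℝ E E ∘L .fst ℝ (E × E) C(I, E)) q w
  have d2 := fderiv_const_apply (.snd ℝ E E ∘L .fst ℝ (E × E) C(I, E)) q w
  have d3 := fderiv_clmApply ((contDiff_nemytskii hB).differentiable (by simp) q)
    (c1.differentiable (by simp) q) w
  have d4 : HasFDerivAt (fun q : (E × E) × C(I, E) ↦
      (⟨B, hB.continuous⟩ : C(E, E →L[ℝ] E)).comp q.2) _ q :=
    (hasFDerivAt_comp (hB.of_le (by simp)) q.2).comp q hasFDerivAt_snd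
  have d5 : HasFDerivAt (fun q : (E × E) × C(I, E) ↦ primitive
      (clmApply I ((⟨B, hB.continuous⟩ : C(E, E →L[ℝ] E)).comp q.2) (.const I q.1.1))) _ q :=
    (primitive (E := E)).hasFDerivAt.comp q
      ((contDiff_primitive_clmApply hB).differentiable (by simp) q).hasFDerivAt
  have h : HasFDerivAt (defect hB) _ q :=
    (hasFDerivAt_snd.sub (c2.differentiable (by simp) q).hasFDerivAt).sub d5
  rw [h.fderiv]
  rw [d1, d4.fderiv] at d3
  change w.2 - fderiv ℝ _ q w - primitive (fderiv ℝ _ q w) = _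
  exact congrArg₂ (fun a b ↦ w.2 - a - primitive b) d2 d3

/-- The map whose local inverse yields the solutions. -/
noncomputable def total (q : (E × E) × C(I, E)) : (E × E) × C(I, E) := (q.1, defect hB q)

lemma contDiff_total : ContDiff ℝ ∞ (total hB) := contDiff_fst.prodMk (contDiff_defect hB)

lemma fderiv_total (q w : (E × E) × C(I, E)) :
    fderiv ℝ (total hB) q w = (w.1, fderiv ℝ (defect hB) q w) := by
  have h : HasFDerivAt (total hB) _ q :=
    hasFDerivAt_fst.prodMk (((contDiff_defect hB).differentiable (by simp)) q).hasFDerivAt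
  rw [h.fderiv]
  rfl

lemma defect_const (y : E) : defect hB ((0, y), .const I y) = 0 := by
  have : ContinuousMap.const I (0 : E) = 0 := rfl
  simp [defect, this]

/-- At `x = 0` the constant path solves the equation, and the `DB` term of the linearization is
multiplied by `x = 0`. So the derivative of the defect in `z` is the identity, and that of `total`
is a shear. -/
lemma exists_local_inverse [CompleteSpace E] (y : E) :
    ∃ e : OpenPartialHomeomorph ((E × E) × C(I, E)) ((E × E) × C(I, E)),
      ((0, y), .const I y) ∈ e.source ∧ ⇑e = total hB ∧ ContDiffOn ℝ ∞ e.symm e.target ∧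
      ∀ q ∈ e.source, (fderiv ℝ (total hB) q).IsInvertible := by
  let L : E × E →L[ℝ] C(I, E) := ContinuousLinearMap.const ℝ I ∘L .snd ℝ E E +
    primitive ∘L clmApply I ((⟨B, hB.continuous⟩ : C(E, E →L[ℝ] E)).comp (.const I y)) ∘L
      ContinuousLinearMap.const ℝ I ∘L .fst ℝ E E
  let g := (ContinuousLinearEquiv.refl ℝ (E × E)).skewProd (ContinuousLinearEquiv.refl ℝ C(I, E)) (-L)
  have hg : HasFDerivAt (total hB) (g : (E × E) × C(I, E) →L[ℝ] (E × E) × C(I, E))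
      ((0, y), .const I y) := by
    have h := ((contDiff_total hB).differentiable (by simp) ((0, y), .const I y)).hasFDerivAt
    convert! h using 1
    refine ContinuousLinearMap.ext fun w ↦ ?_
    rw [fderiv_total, fderiv_defect]
    have h0 : ContinuousMap.const I (0 : E) = 0 := rfl
    refine Prod.ext rfl ?_
    simp only [h0, map_zero, zero_add]
    change w.2 + -(ContinuousMap.const I w.1.2 + _) = _
    rw [neg_add, sub_sub, ← neg_add, ← sub_eq_add_neg]
    rfl
  obtain ⟨e, h1, -, h2, h3, h4⟩ :=
    (contDiff_total hB).contDiffOn.exists_openPartialHomeomorph isOpen_univ (Set.mem_univ _) hg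
  exact ⟨e, h1, h2, h3, h4⟩

/-- If `DB(z)(B(z)v)w` is symmetric in `v` and `w` along a solution `z` then `t ↦ t B(z(t)) v` solves
the linearized equation. -/
lemma fderiv_defect_eq_zero [CompleteSpace E] {x y : E} {z : C(I, E)}
    (hz : defect hB ((x, y), z) = 0)
    (hsym : ∀ t v w, fderiv ℝ B (z t) (B (z t) v) w = fderiv ℝ B (z t) (B (z t) w) v) (v : E) :
    fderiv ℝ (defect hB) ((x, y), z)
      ((v, 0), ⟨fun t ↦ (t : ℝ) • B (z t) v, by have := hB.continuous; fun_prop⟩) = 0 := by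
  have hBc := hB.continuous
  have hBd : Continuous (fderiv ℝ B) := hB.continuous_fderiv (by simp)
  have hz' (t : I) : z t = y + ∫ s in (0 : ℝ)..t, Set.IccExtend zero_le_one (fun t ↦ B (z t) x) s := by
    have h := congr($hz t)
    simp only [defect, ContinuousMap.sub_apply, ContinuousMap.zero_apply] at h
    rw [sub_sub, sub_eq_zero] at h
    exact h
  -- `ζ` extends `z` to all real `t`, so that the integral equation can be differentiated at the end
  -- points as well.
  let ζ (t : ℝ) : E := y + ∫ s in (0 : ℝ)..t, Set.IccExtend zero_le_one (fun t ↦ B (z t) x) s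
  have hζ (t : I) : ζ t = z t := (hz' t).symm
  have hcont : Continuous (Set.IccExtend zero_le_one fun t ↦ B (z t) x) :=
    Continuous.Icc_extend' (by fun_prop)
  have hζd (t : I) : HasDerivAt ζ (B (z t) x) t := by
    have h := (hcont.integral_hasStrictDerivAt 0 (t : ℝ)).hasDerivAt.const_add y
    rwa [Set.IccExtend_val] at h
  have hd (t : I) : HasDerivAt (fun t : ℝ ↦ t • B (ζ t) v)
      ((t : ℝ) • fderiv ℝ B (z t) (B (z t) v) x + B (z t) v) t := by
    have hBf : HasFDerivAt B (fderiv ℝ B (z t)) (ζ t) := by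
      rw [hζ]; exact (hB.differentiable (by simp) _).hasFDerivAt
    have h1 := (hBf.comp_hasDerivAt (t : ℝ) (hζd t)).clm_apply (hasDerivAt_const (t : ℝ) v)
    have h2 := (hasDerivAt_id (t : ℝ)).smul h1
    -- The chain rule produces `DB(z)(B(z)x)v`; symmetry turns it into `DB(z)(B(z)v)x`, the term of
    -- the linearized equation.
    simp only [map_zero, add_zero, Function.comp_apply, id, one_smul, hζ, hsym t x v] at h2
    exact h2
  rw [fderiv_defect]
  have h0 : ContinuousMap.const I (0 : E) = 0 := rfl
  simp only [h0, sub_zero]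
  rw [sub_eq_zero]
  ext t
  rw [primitive_apply]
  have h1 := intervalIntegral.integral_eq_sub_of_hasDerivAt (a := 0) (b := (t : ℝ))
    (f := fun t : ℝ ↦ t • B (ζ t) v)
    (f' := Set.IccExtend zero_le_one fun t : I ↦
      (t : ℝ) • fderiv ℝ B (z t) (B (z t) v) x + B (z t) v) (fun s hs ↦ ?_)
    ((Continuous.Icc_extend' (by fun_prop)).intervalIntegrable _ _)
  · rw [zero_smul, sub_zero, hζ] at h1
    refine h1.symm.trans (congrArg (fun f : ℝ → E ↦ ∫ s in (0 : ℝ)..t, f s) ?_)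
    congr 1
    ext s
    simp
  · rw [Set.uIcc_of_le t.2.1] at hs
    have hs' : s ∈ Set.Icc (0 : ℝ) 1 := ⟨hs.1, hs.2.trans t.2.2⟩
    rw [Set.IccExtend_of_mem _ _ hs']
    exact hd ⟨s, hs'⟩

/-- Smooth solutions of `∂ₓ Z(x, y) = B(Z(x, y))`, `Z(0, y) = y`, if `DB(z)(B(z)v)w` is symmetric in
`v` and `w`. -/
theorem exists_solution [CompleteSpace E] (hB : ContDiff ℝ ∞ B) (a : E) {V : Set E} (hV : V ∈ 𝓝 a)
    (hsym : ∀ z ∈ V, ∀ v w, fderiv ℝ B z (B z v) w = fderiv ℝ B z (B z w) v) :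
    ∃ (Z : E × E → E) (U : Set (E × E)), IsOpen U ∧ (0, a) ∈ U ∧ ContDiffOn ℝ ∞ Z U ∧
      (∀ q ∈ U, Z q ∈ V ∧ ∀ v, fderiv ℝ Z q (v, 0) = B (Z q) v) ∧
      ∀ᶠ y in 𝓝 a, Z (0, y) = y := by
  obtain ⟨e, ha, hcoe, hsmooth, hinv⟩ := exists_local_inverse hB a
  obtain ⟨r, hr, hrV⟩ := Metric.mem_nhds_iff.1 hV
  -- `ψ (x, y)` is the solution path with data `x`, `y`: the preimage of defect zero under the
  -- smooth local inverse.
  let ψ (p : E × E) : C(I, E) := (e.symm (p, 0)).2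
  let P : Set (E × E) := (fun p ↦ (p, (0 : C(I, E)))) ⁻¹' e.target
  have hP : IsOpen P := e.open_target.preimage (by fun_prop)
  have hψ : ContDiffOn ℝ ∞ ψ P :=
    contDiff_snd.comp_contDiffOn (hsmooth.comp (by fun_prop) fun p hp ↦ hp)
  have htot {p} (hp : p ∈ P) : total hB (e.symm (p, 0)) = (p, 0) := by
    rw [← hcoe]; exact e.right_inv hp
  have hsymm {p} (hp : p ∈ P) : e.symm (p, 0) = (p, ψ p) :=
    Prod.ext congr(($(htot hp)).1) rfl
  have hdef {p} (hp : p ∈ P) : defect hB (p, ψ p) = 0 := by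
    rw [← hsymm hp]; exact congr(($(htot hp)).2)
  have hbase (y : E) (hy : ((0, y), ContinuousMap.const I y) ∈ e.source) :
      (0, y) ∈ P ∧ ψ (0, y) = .const I y := by
    have h1 : e ((0, y), .const I y) = ((0, y), 0) := by
      rw [hcoe, total, defect_const]
    have h2 := e.map_source hy
    have h3 := e.left_inv hy
    rw [h1] at h2 h3
    exact ⟨h2, congr(($h3).2)⟩
  -- The symmetry hypothesis is needed along the whole path, so the whole path is kept in `V`.
  let U := P ∩ ψ ⁻¹' Metric.ball (.const I a) r
  have hUo : IsOpen U := hψ.continuousOn.isOpen_inter_preimage hP Metric.isOpen_ball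
  let Z (p : E × E) : E := ψ p 1
  have hmem {p} (hp : p ∈ U) (t : I) : ψ p t ∈ V :=
    hrV ((ContinuousMap.dist_apply_le_dist t).trans_lt hp.2)
  let ev : C(I, E) →L[ℝ] E := ContinuousMap.evalCLM ℝ 1
  refine ⟨Z, U, hUo, ⟨(hbase a ha).1, ?_⟩,
    ev.contDiff.comp_contDiffOn (hψ.mono Set.inter_subset_left),
    fun p hp ↦ ⟨hmem hp 1, fun v ↦ ?_⟩, ?_⟩
  · rw [Set.mem_preimage, (hbase a ha).2]
    exact Metric.mem_ball_self hr
  · have hd : DifferentiableAt ℝ ψ p :=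
      (hψ.contDiffAt (hP.mem_nhds hp.1)).differentiableAt (by simp)
    have hid := hasFDerivAt_id (𝕜 := ℝ) p
    have hg : HasFDerivAt (fun p ↦ (p, ψ p)) _ p := hid.prodMk hd.hasFDerivAt
    have h1 : HasFDerivAt (fun p ↦ total hB (p, ψ p)) _ p :=
      HasFDerivAt.comp (g := total hB) p
        ((contDiff_total hB).differentiable (by simp) (p, ψ p)).hasFDerivAt hg
    have h2 : (fun p ↦ total hB (p, ψ p)) =ᶠ[𝓝 p] fun p ↦ (p, 0) := by
      filter_upwards [hP.mem_nhds hp.1] with p' hp'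
      rw [total, hdef hp']
    have h3 : HasFDerivAt (fun p : E × E ↦ (p, (0 : C(I, E)))) _ p :=
      hid.prodMk (hasFDerivAt_const 0 p)
    have h4 := congr($((h1.congr_of_eventuallyEq h2.symm).unique h3) (v, 0))
    have h5 := fderiv_defect_eq_zero hB (hdef hp.1) (fun t ↦ hsym _ (hmem hp t)) v
    have hsrc : (p, ψ p) ∈ e.source := by
      rw [← hsymm hp.1]; exact e.map_target hp.1
    -- Both vectors are sent to `((v, 0), 0)`: the first by differentiating `total (p, ψ p) = (p,
    -- 0)`, the second by the linearized equation. Invertibility identifies them, and evaluation at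
    -- `t = 1` gives the claim.
    have h6 : fderiv ℝ (total hB) (p, ψ p) ((v, 0), fderiv ℝ ψ p (v, 0)) =
        fderiv ℝ (total hB) (p, ψ p) ((v, 0), ⟨fun t ↦ (t : ℝ) • B (ψ p t) v, by
          have := hB.continuous; fun_prop⟩) := by
      refine Eq.trans (b := ((v, (0 : E)), (0 : C(I, E)))) h4 ?_
      rw [fderiv_total, h5]
    have h7 := congr(($((hinv _ hsrc).injective h6)).2 1)
    have h8 : HasFDerivAt Z _ p := ev.hasFDerivAt.comp p hd.hasFDerivAt
    rw [h8.fderiv]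
    refine h7.trans ?_
    simp [Z]
  · have hc : Continuous fun y : E ↦ (((0 : E), y), ContinuousMap.const I y) :=
      (continuous_const.prodMk continuous_id).prodMk
        (ContinuousLinearMap.const ℝ (M := E) I).continuous
    filter_upwards [hc.continuousAt.preimage_mem_nhds (e.open_source.mem_nhds ha)] with y hy
    simp [Z, (hbase y hy).2]

end RadialODE

/-! ### The Frobenius theorem in a vector space -/

/-- A map that is smooth near `a` agrees near `a` with a globally smooth map. -/
lemma ContDiffOn.exists_contDiff_eventuallyEq {E F : Type*} [NormedAddCommGroup E] [NormedSpace ℝ E]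
    [FiniteDimensional ℝ E] [NormedAddCommGroup F] [NormedSpace ℝ F] {f : E → F} {W : Set E}
    (hf : ContDiffOn ℝ ∞ f W) {a : E} (hW : W ∈ 𝓝 a) :
    ∃ g : E → F, ContDiff ℝ ∞ g ∧ g =ᶠ[𝓝 a] f := by
  obtain ⟨r, hr, hrW⟩ := Metric.mem_nhds_iff.1 hW
  let ρ : ContDiffBump a := ⟨r / 4, r / 2, by linarith, by linarith⟩
  refine ⟨fun x ↦ ρ x • f x, contDiff_iff_contDiffAt.2 fun x ↦ ?_, ?_⟩
  · by_cases hx : x ∈ tsupport ρ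
    · rw [ρ.tsupport_eq] at hx
      have hxr : x ∈ Metric.ball a r :=
        Metric.closedBall_subset_ball (by change r / 2 < r; linarith) hx
      exact ρ.contDiff.contDiffAt.smul
        (hf.contDiffAt (Filter.mem_of_superset (Metric.isOpen_ball.mem_nhds hxr) hrW))
    · refine (contDiffAt_const (c := (0 : F))).congr_of_eventuallyEq ?_
      filter_upwards [(isClosed_tsupport ρ).isOpen_compl.mem_nhds hx] with y hy
      rw [image_eq_zero_of_notMem_tsupport hy, zero_smul]
  · filter_upwards [ρ.eventuallyEq_one] with x hx
    rw [hx, Pi.one_apply, one_smul]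

/-- A local form of the Frobenius theorem: `Θ` straightens the distribution spanned by the `B(x)v`,
`v ∈ im P`. -/
theorem exists_straightening {E : Type u} [NormedAddCommGroup E] [NormedSpace ℝ E]
    [FiniteDimensional ℝ E] {B : E → E →L[ℝ] E} {W : Set E} (hW : IsOpen W) {a : E} (ha : a ∈ W)
    (hB : ContDiffOn ℝ ∞ B W) {P : E →L[ℝ] E} (hP : ∀ v, P (P v) = P v) (hBa : B a = P)
    (hsym : ∀ x ∈ W, ∀ v w, fderiv ℝ B x (B x v) w = fderiv ℝ B x (B x w) v) :
    ∃ Θ : OpenPartialHomeomorph E E, 0 ∈ Θ.source ∧ Θ 0 = a ∧ Θ.target ⊆ W ∧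
      ContDiffOn ℝ ∞ Θ Θ.source ∧ ContDiffOn ℝ ∞ Θ.symm Θ.target ∧
      (∀ c ∈ Θ.source, (fderiv ℝ Θ c).IsInvertible) ∧
      ∀ c ∈ Θ.source, ∀ v, P v = v → fderiv ℝ Θ c v = B (Θ c) v := by
  have : CompleteSpace E := FiniteDimensional.complete ℝ E
  obtain ⟨B', hB', hBB'⟩ := hB.exists_contDiff_eventuallyEq (hW.mem_nhds ha)
  obtain ⟨V, hVsub, hVo, haV⟩ := mem_nhds_iff.1
    (Filter.inter_mem (hW.mem_nhds ha) (eventually_eventually_nhds.2 hBB'))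
  have hB'V {x} (hx : x ∈ V) : B' x = B x := (hVsub hx).2.self_of_nhds
  obtain ⟨Z, U, hUo, haU, hZ, hZU, hZ0⟩ := RadialODE.exists_solution hB' a (hVo.mem_nhds haV)
    fun x hx v w ↦ by
      rw [Filter.EventuallyEq.fderiv_eq (hVsub hx).2, hB'V hx, hsym x (hVsub hx).1]
  -- The component `Pc` plays the role of the time `x`, and `c - Pc` displaces the initial point
  -- from `a`. At `c = 0` the derivative of `Θ` is then `P + (id - P) = id`.
  let ℓ : E →L[ℝ] E × E := P.prod (.id ℝ E - P)
  let m (c : E) : E × E := (0, a) + ℓ c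
  have hm (c : E) : HasFDerivAt m ℓ c := ℓ.hasFDerivAt.const_add _
  have hmc : ContDiff ℝ ∞ m := contDiff_const.add ℓ.contDiff
  have hm0 : m 0 = (0, a) := by simp [m]
  let Θ (c : E) : E := Z (m c)
  let U' := m ⁻¹' U
  have hU'o : IsOpen U' := hUo.preimage hmc.continuous
  have h0U' : (0 : E) ∈ U' := by rw [Set.mem_preimage, hm0]; exact haU
  have hΘ : ContDiffOn ℝ ∞ Θ U' := hZ.comp hmc.contDiffOn fun c hc ↦ hc
  have hΘd {c : E} (hc : c ∈ U') : HasFDerivAt Θ (fderiv ℝ Z (m c) ∘L ℓ) c :=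
    ((hZ.contDiffAt (hUo.mem_nhds hc)).differentiableAt (by simp)).hasFDerivAt.comp c (hm c)
  have hZ0a : Z (0, a) = a := hZ0.self_of_nhds
  have hΘ0 : Θ 0 = a := by simp only [Θ, hm0, hZ0a]
  have hZy (y : E) : fderiv ℝ Z (0, a) (0, y) = y := by
    have h1 : HasFDerivAt (fun y ↦ Z (0, y)) _ a :=
      HasFDerivAt.comp (g := Z) (f := fun y : E ↦ ((0 : E), y)) a
        ((hZ.contDiffAt (hUo.mem_nhds haU)).differentiableAt (by simp)).hasFDerivAt
        ((hasFDerivAt_const (0 : E) a).prodMk (hasFDerivAt_id a))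
    have h2 : HasFDerivAt (fun y ↦ Z (0, y)) (.id ℝ E) a :=
      (hasFDerivAt_id a).congr_of_eventuallyEq hZ0
    exact congr($(h1.unique h2) y)
  have hΘ' : HasFDerivAt Θ ((ContinuousLinearEquiv.refl ℝ E : E ≃L[ℝ] E) : E →L[ℝ] E) 0 := by
    convert! hΘd h0U' using 1
    ext c
    have h1 : ℓ c = (P c, 0) + (0, c - P c) := by simp [ℓ]
    rw [ContinuousLinearMap.comp_apply, hm0, h1, map_add, (hZU _ haU).2, hZy, hZ0a, hB'V haV, hBa,
      hP]
    simp
  obtain ⟨e, h0, heU, hcoe, hsymm, hinv⟩ := hΘ.exists_openPartialHomeomorph hU'o h0U' hΘ'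
  refine ⟨e, h0, by rw [hcoe, hΘ0], fun x hx ↦ ?_, ?_, hsymm, ?_, fun c hc v hv ↦ ?_⟩
  · have h1 := (hZU _ (heU (e.map_target hx))).1
    have h2 : Θ (e.symm x) = x := by rw [← hcoe, e.right_inv hx]
    exact h2 ▸ (hVsub h1).1
  · rw [hcoe]; exact hΘ.mono heU
  · rw [hcoe]; exact hinv
  · have h1 := hZU _ (heU hc)
    have h2 : ℓ v = (v, 0) := by simp [ℓ, hv]
    rw [hcoe, (hΘd (heU hc)).fderiv, ContinuousLinearMap.comp_apply, h2, h1.2, hB'V h1.1]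

section

variable {E : Type u} [NormedAddCommGroup E] [NormedSpace ℝ E] [FiniteDimensional ℝ E]

/-- A smooth family of projections of constant rank is near `a` parametrized by its value at `a`. -/
lemma exists_contDiffOn_section_of_projection {Q : E → E →L[ℝ] E} {W : Set E} (hW : IsOpen W)
    {a : E} (ha : a ∈ W) (hQ : ContDiffOn ℝ ∞ Q W) (hidem : ∀ x ∈ W, ∀ v, Q x (Q x v) = Q x v)
    {n : ℕ} (hrank : ∀ x ∈ W, Module.finrank ℝ (LinearMap.range (Q x).toLinearMap) = n) :
    ∃ (B : E → E →L[ℝ] E) (W' : Set E), IsOpen W' ∧ a ∈ W' ∧ W' ⊆ W ∧ ContDiffOn ℝ ∞ B W' ∧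
      B a = Q a ∧ ∀ x ∈ W', ∀ v, Q x (B x v) = B x v ∧ Q a (B x v) = Q a v ∧
        (Q x v = v → B x (Q a v) = v) := by
  have : CompleteSpace E := FiniteDimensional.complete ℝ E
  -- `T a` is the identity and `Q a ∘ T x = Q a ∘ Q x`. Hence `Q x ∘ (T x)⁻¹ ∘ Q a` writes the range
  -- of `Q x` as a graph over the range of `Q a`.
  let T (x : E) : E →L[ℝ] E := Q a ∘L Q x + (.id ℝ E - Q a)
  have hT : ContDiffOn ℝ ∞ T W := (contDiffOn_const.clm_comp hQ).add contDiffOn_const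
  have hTa : T a = (ContinuousLinearEquiv.refl ℝ E : E →L[ℝ] E) := by
    ext v
    simp [T, hidem a ha]
  have hinv : ∀ᶠ x in 𝓝 a, (T x).IsInvertible := by
    refine (hT.continuousOn.continuousAt (hW.mem_nhds ha)).eventually ?_
    rw [hTa]
    exact ContinuousLinearEquiv.nhds _
  obtain ⟨W', hW', hW'o, haW'⟩ := mem_nhds_iff.1 (Filter.inter_mem (hW.mem_nhds ha) hinv)
  let B (x : E) : E →L[ℝ] E := Q x ∘L (T x).inverse ∘L Q a
  have h1 {x} (hx : x ∈ W') (v) : Q x (B x v) = B x v := hidem x (hW' hx).1 _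
  have h2 {x} (hx : x ∈ W') (v) : Q a (B x v) = Q a v := by
    obtain ⟨e, he⟩ := (hW' hx).2
    have h3 (w) : Q a (T x w) = Q a (Q x w) := by simp [T, hidem a ha]
    have h4 : T x ((T x).inverse (Q a v)) = Q a v := by
      rw [← he, ContinuousLinearMap.inverse_equiv]
      exact e.apply_symm_apply _
    change Q a (Q x ((T x).inverse (Q a v))) = _
    rw [← h3, h4, hidem a ha]
  refine ⟨B, W', hW'o, haW', fun x hx ↦ (hW' hx).1, fun x hx ↦ ?_, ?_, fun x hx v ↦
    ⟨h1 hx v, h2 hx v, fun hv ↦ ?_⟩⟩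
  · have hx' := hW.mem_nhds (hW' hx).1
    obtain ⟨e, he⟩ := (hW' hx).2
    have h3 : ContDiffAt ℝ ∞ (fun y ↦ (T y).inverse) x := by
      have h4 : ContDiffAt ℝ ∞ ContinuousLinearMap.inverse (T x) := by
        rw [← he]
        exact contDiffAt_map_inverse e
      exact h4.comp x (hT.contDiffAt hx')
    exact ((hQ.contDiffAt hx').clm_comp (h3.clm_comp contDiffAt_const)).contDiffWithinAt
  · ext v
    simp only [B]
    rw [hTa, ContinuousLinearMap.inverse_equiv]
    exact hidem a ha v
  -- `B x` embeds the range of `Q a` into that of `Q x`; equality of ranks makes it onto.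
  · let b : LinearMap.range (Q a).toLinearMap →ₗ[ℝ] LinearMap.range (Q x).toLinearMap :=
      (B x).toLinearMap.restrict fun w _ ↦ ⟨_, h1 hx w⟩
    have hb : Function.Injective b := by
      refine LinearMap.ker_eq_bot.1 (LinearMap.ker_eq_bot'.2 fun w hw ↦ Subtype.ext ?_)
      obtain ⟨-, w, rfl⟩ := w
      have h3 : B x (Q a w) = 0 := congr(($hw : E))
      have h4 := h2 hx (Q a w)
      rw [h3, map_zero, hidem a ha] at h4
      exact h4.symm
    have hs := (LinearMap.injective_iff_surjective_of_finrank_eq_finrank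
      (by rw [hrank a ha, hrank x (hW' hx).1])).1 hb
    obtain ⟨⟨-, w, rfl⟩, hw⟩ := hs ⟨v, v, hv⟩
    have h3 : B x (Q a w) = v := congr(($hw : E))
    have h4 := h2 hx (Q a w)
    rw [h3, hidem a ha] at h4
    rw [h4, h3]

/-- The Frobenius theorem for the range of a smooth family `Q` of projections of constant rank in
a vector space. -/
theorem exists_straightening_of_projection {Q : E → E →L[ℝ] E} {W : Set E} (hW : IsOpen W)
    {a : E} (ha : a ∈ W) (hQ : ContDiffOn ℝ ∞ Q W) (hidem : ∀ x ∈ W, ∀ v, Q x (Q x v) = Q x v)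
    {n : ℕ} (hrank : ∀ x ∈ W, Module.finrank ℝ (LinearMap.range (Q x).toLinearMap) = n)
    (hinv : ∀ x ∈ W, ∀ X Y : E → E, ContDiffAt ℝ ∞ X x → ContDiffAt ℝ ∞ Y x →
      (∀ᶠ y in 𝓝 x, Q y (X y) = X y) → (∀ᶠ y in 𝓝 x, Q y (Y y) = Y y) →
      Q x (fderiv ℝ Y x (X x) - fderiv ℝ X x (Y x)) =
        fderiv ℝ Y x (X x) - fderiv ℝ X x (Y x)) :
    ∃ Θ : OpenPartialHomeomorph E E, 0 ∈ Θ.source ∧ Θ 0 = a ∧ Θ.target ⊆ W ∧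
      ContDiffOn ℝ ∞ Θ Θ.source ∧ ContDiffOn ℝ ∞ Θ.symm Θ.target ∧
      (∀ c ∈ Θ.source, (fderiv ℝ Θ c).IsInvertible) ∧
      ∀ c ∈ Θ.source, ∀ v, Q (Θ c) (fderiv ℝ Θ c v) = fderiv ℝ Θ c v ↔ Q a v = v := by
  obtain ⟨B, W', hW'o, haW', hW'W, hB, hBa, hBQ⟩ :=
    exists_contDiffOn_section_of_projection hW ha hQ hidem hrank
  obtain ⟨Θ, h0, hΘ0, htar, hΘ, hΘsymm, hΘinv, hΘB⟩ := exists_straightening hW'o haW' hB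
    (hidem a ha) hBa fun x hx v w ↦ by
    have hBx := hB.contDiffAt (hW'o.mem_nhds hx)
    have hBd := hBx.differentiableAt (by simp)
    have hBv (v) : ContDiffAt ℝ ∞ (fun y ↦ B y v) x := hBx.clm_apply contDiffAt_const
    have hQB (v) : ∀ᶠ y in 𝓝 x, Q y (B y v) = B y v := by
      filter_upwards [hW'o.mem_nhds hx] with y hy using (hBQ y hy v).1
    have hd (v u) : fderiv ℝ (fun y ↦ B y v) x u = fderiv ℝ B x u v := by
      rw [fderiv_clm_apply hBd (differentiableAt_const v)]
      simp
    have h1 := hinv x (hW'W hx) _ _ (hBv v) (hBv w) (hQB v) (hQB w)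
    simp only [hd] at h1
    -- `Q a (B y v)` does not depend on `y`, so `Q a` kills the derivatives of the frame fields and
    -- thereby their bracket. The bracket also lies in the range of `Q x`, where `Q a` is injective,
    -- so it is zero.
    have h2 (v u) : Q a (fderiv ℝ B x u v) = 0 := by
      have h3 : (fun y ↦ Q a (B y v)) =ᶠ[𝓝 x] fun _ ↦ Q a v := by
        filter_upwards [hW'o.mem_nhds hx] with y hy using (hBQ y hy v).2.1
      have h4 := congr($(h3.fderiv_eq (𝕜 := ℝ)) u)
      have h5 : HasFDerivAt (fun y ↦ Q a (B y v)) _ x :=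
        (Q a).hasFDerivAt.comp x ((hBv v).differentiableAt (by simp)).hasFDerivAt
      rw [h5.fderiv, ContinuousLinearMap.comp_apply, hd] at h4
      simpa using h4
    have h3 := (hBQ x hx _).2.2 h1
    rw [map_sub, h2, h2, sub_zero, map_zero, eq_comm, sub_eq_zero] at h3
    exact h3
  refine ⟨Θ, h0, hΘ0, htar.trans hW'W, hΘ, hΘsymm, hΘinv, fun c hc v ↦ ?_⟩
  have hx := htar (Θ.map_source hc)
  constructor
  · intro hv
    have h1 := (hBQ _ hx _).2.2 hv
    rw [← hΘB c hc _ (hidem a ha _)] at h1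
    have h2 := (hΘinv c hc).injective h1
    rw [← h2, hidem a ha]
  · intro hv
    rw [hΘB c hc v hv]
    exact (hBQ _ hx v).1

end

/-! ### The Frobenius theorem on a manifold -/

section

open VectorField FiberBundle

variable {E : Type u} [NormedAddCommGroup E] [NormedSpace ℝ E] [FiniteDimensional ℝ E]
  [CompleteSpace E] {H : Type*} [TopologicalSpace H] {I : ModelWithCorners ℝ E H}
  {M : Type*} [TopologicalSpace M] [ChartedSpace H M] [IsManifold I ∞ M]
  {F F' : Type*} [NormedAddCommGroup F] [NormedSpace ℝ F] [NormedAddCommGroup F'] [NormedSpace ℝ F']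

lemma mvfderiv_comp_apply' {g : F → F'} {f : M → F} {p : M} (hg : DifferentiableAt ℝ g (f p))
    (hf : MDiffAt f p) (v : TangentSpace I p) :
    mvfderiv I (g ∘ f) p v = fderiv ℝ g (f p) (mvfderiv I f p v) := by
  have h := mfderiv_comp p hg.mdifferentiableAt hf
  rw [mfderiv_eq_fderiv] at h
  exact congr($h v)

lemma tangentCoframe_eq_mvfderiv {p q : M} (hq : q ∈ (chartAt H p).source)
    (v : TangentSpace I q) : tangentCoframe I p q v = mvfderiv I (extChartAt I p) q v := by
  have hI1 : IsManifold I 1 M := IsManifold.of_le (n := ∞) (by simp)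
  exact congr($(TangentBundle.continuousLinearMapAt_trivializationAt (I := I) hq) v)

/-- An endomorphism field read in the frame `tangentFrame I p`. -/
noncomputable def endInFrame (Q : Π q : M, TangentSpace I q →L[ℝ] TangentSpace I q) (p q : M) :
    E →L[ℝ] E :=
  tangentCoframe I p q ∘L Q q ∘L tangentFrame I p q

variable {Q : Π q : M, TangentSpace I q →L[ℝ] TangentSpace I q} {p q : M}

lemma endInFrame_apply (v : E) :
    endInFrame Q p q v = tangentCoframe I p q (Q q (tangentFrame I p q v)) := rfl

lemma endInFrame_coframe_eq_iff (hq : q ∈ (chartAt H p).source) (v : TangentSpace I q) :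
    endInFrame Q p q (tangentCoframe I p q v) = tangentCoframe I p q v ↔ Q q v = v := by
  rw [endInFrame_apply, tangentFrame_coframe hq]
  refine ⟨fun h ↦ ?_, fun h ↦ by rw [h]⟩
  rw [← tangentFrame_coframe hq (Q q v), h, tangentFrame_coframe hq]

lemma endInFrame_eq_iff (hq : q ∈ (chartAt H p).source) (v : E) :
    endInFrame Q p q v = v ↔ Q q (tangentFrame I p q v) = tangentFrame I p q v := by
  rw [← endInFrame_coframe_eq_iff hq, tangentCoframe_frame hq]

lemma finrank_range_endInFrame (hq : q ∈ (chartAt H p).source) :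
    Module.finrank ℝ (LinearMap.range (endInFrame Q p q).toLinearMap) =
      Module.finrank ℝ (LinearMap.range (Q q).toLinearMap) := by
  let e : TangentSpace I q ≃ₗ[ℝ] E := LinearEquiv.ofLinearMap (tangentCoframe I p q).toLinearMap
    (tangentFrame I p q).toLinearMap (LinearMap.ext (tangentCoframe_frame hq))
    (LinearMap.ext (tangentFrame_coframe hq))
  have h : LinearMap.range (endInFrame Q p q).toLinearMap =
      (LinearMap.range (Q q).toLinearMap).map e.toLinearMap := by
    ext u
    simp only [LinearMap.mem_range, Submodule.mem_map]
    constructor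
    · rintro ⟨v, rfl⟩
      exact ⟨_, ⟨tangentFrame I p q v, rfl⟩, rfl⟩
    · rintro ⟨-, ⟨v, rfl⟩, rfl⟩
      refine ⟨tangentCoframe I p q v, ?_⟩
      change endInFrame Q p q _ = _
      rw [endInFrame_apply, tangentFrame_coframe hq]
      rfl
  rw [h]
  exact LinearEquiv.finrank_map_eq e _

lemma contMDiffAt_endInFrame {p' : M} (hp : p' ∈ (chartAt H p).source)
    (hQ : ∀ X : Π q : M, TangentSpace I q, CMDiffAt ∞ (T% X) p' →
      CMDiffAt ∞ (T% (fun q ↦ Q q (X q))) p') :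
    CMDiffAt ∞ (endInFrame Q p) p' :=
  contMDiffAt_clm_of_apply fun _ ↦ contMDiffAt_tangentCoframe_of_mem hp
    (hQ _ (contMDiffAt_tangentFrame_of_mem hp contMDiffAt_const))

/-- In a chart, a projection field whose range is involutive is involutive. -/
lemma endInFrame_involutive [I.Boundaryless] {p' : M} (hp : p' ∈ (chartAt H p).source)
    (hinv : ∀ X Y : Π q : M, TangentSpace I q, CMDiffAt ∞ (T% X) p' → CMDiffAt ∞ (T% Y) p' →
      (∀ᶠ q in 𝓝 p', Q q (X q) = X q) → (∀ᶠ q in 𝓝 p', Q q (Y q) = Y q) →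
      Q p' (mlieBracket I X Y p') = mlieBracket I X Y p')
    {X Y : E → E} (hX : ContDiffAt ℝ ∞ X (extChartAt I p p'))
    (hY : ContDiffAt ℝ ∞ Y (extChartAt I p p'))
    (hQX : ∀ᶠ q in 𝓝 p', endInFrame Q p q (X (extChartAt I p q)) = X (extChartAt I p q))
    (hQY : ∀ᶠ q in 𝓝 p', endInFrame Q p q (Y (extChartAt I p q)) = Y (extChartAt I p q)) :
    endInFrame Q p p' (fderiv ℝ Y (extChartAt I p p') (X (extChartAt I p p')) -
      fderiv ℝ X (extChartAt I p p') (Y (extChartAt I p p'))) =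
      fderiv ℝ Y (extChartAt I p p') (X (extChartAt I p p')) -
        fderiv ℝ X (extChartAt I p p') (Y (extChartAt I p p')) := by
  have hs : ∀ᶠ q in 𝓝 p', q ∈ (chartAt H p).source := (chartAt H p).open_source.mem_nhds hp
  have he : CMDiffAt ∞ (extChartAt I p) p' := contMDiffAt_extChartAt' hp
  let L (X : E → E) (q : M) : TangentSpace I q := tangentFrame I p q (X (extChartAt I p q))
  have hL {X : E → E} (hX : ContDiffAt ℝ ∞ X (extChartAt I p p')) : CMDiffAt ∞ (T% (L X)) p' :=
    contMDiffAt_tangentFrame_of_mem hp (hX.contMDiffAt.comp p' he)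
  have hQL {X : E → E}
      (hQX : ∀ᶠ q in 𝓝 p', endInFrame Q p q (X (extChartAt I p q)) = X (extChartAt I p q)) :
      ∀ᶠ q in 𝓝 p', Q q (L X q) = L X q := by
    filter_upwards [hQX, hs] with q h1 h2 using (endInFrame_eq_iff h2 _).1 h1
  have hde (X : E → E) {q : M} (hq : q ∈ (chartAt H p).source) :
      mvfderiv I (extChartAt I p) q (L X q) = X (extChartAt I p q) := by
    rw [← tangentCoframe_eq_mvfderiv hq, tangentCoframe_frame hq]
  have hdd (X : E → E) {Y : E → E} (hY : ContDiffAt ℝ ∞ Y (extChartAt I p p')) :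
      mvfderiv I (fun q ↦ mvfderiv I (extChartAt I p) q (L Y q)) p' (L X p') =
        fderiv ℝ Y (extChartAt I p p') (X (extChartAt I p p')) := by
    have h1 : (fun q ↦ mvfderiv I (extChartAt I p) q (L Y q)) =ᶠ[𝓝 p'] Y ∘ extChartAt I p := by
      filter_upwards [hs] with q hq using hde Y hq
    rw [h1.mvfderiv_eq, mvfderiv_comp_apply' (hY.differentiableAt (by simp))
      (he.mdifferentiableAt (by simp)), hde X hp]
  -- Applied to the vector-valued chart map, the commutator formula expresses the bracket of the
  -- lifted fields by the coordinate bracket of `X` and `Y`.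
  have h1 := mvfderiv_mlieBracket he (hL hX) (hL hY)
  rw [hdd X hY, hdd Y hX] at h1
  rw [← h1, ← tangentCoframe_eq_mvfderiv hp, endInFrame_coframe_eq_iff hp]
  exact hinv _ _ (hL hX) (hL hY) (hQL hQX) (hQL hQY)

end

section

open VectorField FiberBundle

variable {E : Type u} [NormedAddCommGroup E] [NormedSpace ℝ E] [FiniteDimensional ℝ E]
  {M : Type*} [TopologicalSpace M] [ChartedSpace E M] [IsManifold 𝓘(ℝ, E) ∞ M]

/-- The Frobenius theorem: charts that straighten the involutive range of a smooth field of
projections of constant rank. -/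
theorem exists_straightening_chart {Q : Π q : M, TangentSpace 𝓘(ℝ, E) q →L[ℝ] TangentSpace 𝓘(ℝ, E) q}
    (hQ : ∀ (p : M) (X : Π q : M, TangentSpace 𝓘(ℝ, E) q), CMDiffAt ∞ (T% X) p →
      CMDiffAt ∞ (T% (fun q ↦ Q q (X q))) p)
    (hidem : ∀ (q : M) (v : TangentSpace 𝓘(ℝ, E) q), Q q (Q q v) = Q q v) {n : ℕ}
    (hrank : ∀ q : M, Module.finrank ℝ (LinearMap.range (Q q).toLinearMap) = n)
    (hinv : ∀ (p : M) (X Y : Π q : M, TangentSpace 𝓘(ℝ, E) q),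
      CMDiffAt ∞ (T% X) p → CMDiffAt ∞ (T% Y) p →
      (∀ᶠ q in 𝓝 p, Q q (X q) = X q) → (∀ᶠ q in 𝓝 p, Q q (Y q) = Y q) →
      Q p (mlieBracket 𝓘(ℝ, E) X Y p) = mlieBracket 𝓘(ℝ, E) X Y p) (p : M) :
    ∃ (e : OpenPartialHomeomorph M E) (P : E →L[ℝ] E), p ∈ e.source ∧
      e ∈ IsManifold.maximalAtlas 𝓘(ℝ, E) ∞ M ∧ (∀ v, P (P v) = P v) ∧
      Module.finrank ℝ (LinearMap.range P.toLinearMap) = n ∧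
      ∀ q ∈ e.source, ∀ v : TangentSpace 𝓘(ℝ, E) q,
        P (mvfderiv 𝓘(ℝ, E) e q v) = mvfderiv 𝓘(ℝ, E) e q v ↔ Q q v = v := by
  have : CompleteSpace E := FiniteDimensional.complete ℝ E
  let e₀ := chartAt E p
  have hext (q : M) : extChartAt 𝓘(ℝ, E) p q = e₀ q := rfl
  let R (x : E) : E →L[ℝ] E := endInFrame Q p (e₀.symm x)
  have hmem {x} (hx : x ∈ e₀.target) : e₀.symm x ∈ e₀.source := e₀.map_target hx
  have hidem' {q : M} (hq : q ∈ e₀.source) (v : E) :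
      endInFrame Q p q (endInFrame Q p q v) = endInFrame Q p q v := by
    rw [endInFrame_apply (v := v), endInFrame_coframe_eq_iff hq, hidem]
  have hsm : ContMDiffOn 𝓘(ℝ, E) 𝓘(ℝ, E) ∞ e₀ e₀.source := contMDiffOn_chart
  have hsm' : ContMDiffOn 𝓘(ℝ, E) 𝓘(ℝ, E) ∞ e₀.symm e₀.target := contMDiffOn_chart_symm
  have hR : ContDiffOn ℝ ∞ R e₀.target := fun x hx ↦
    (contMDiffAt_iff_contDiffAt.1 (ContMDiffAt.comp x (contMDiffAt_endInFrame (hmem hx) (hQ _))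
      (hsm'.contMDiffAt (e₀.open_target.mem_nhds hx)))).contDiffWithinAt
  have hev {x} (hx : x ∈ e₀.target) {X : E → E} (hX : ∀ᶠ y in 𝓝 x, R y (X y) = X y) :
      ∀ᶠ q in 𝓝 (e₀.symm x), endInFrame Q p q (X (e₀ q)) = X (e₀ q) := by
    have h1 : Filter.Tendsto e₀ (𝓝 (e₀.symm x)) (𝓝 x) := by
      have h2 := (e₀.continuousAt (hmem hx)).tendsto
      rwa [e₀.right_inv hx] at h2
    filter_upwards [h1.eventually hX, e₀.open_source.mem_nhds (hmem hx)] with q h2 h3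
    simpa only [R, e₀.left_inv h3] using h2
  have hp : p ∈ e₀.source := mem_chart_source E p
  obtain ⟨Θ, h0, hΘ0, htar, hΘ, hΘsymm, hΘinv, hΘR⟩ :=
    exists_straightening_of_projection e₀.open_target (e₀.map_source hp) hR
      (fun x hx v ↦ hidem' (hmem hx) v)
      (fun x hx ↦ (finrank_range_endInFrame (hmem hx)).trans (hrank _))
      (fun x hx X Y hX hY hRX hRY ↦ by
        have h := endInFrame_involutive (hmem hx) (hinv (e₀.symm x)) (X := X) (Y := Y)
          (by rwa [hext, e₀.right_inv hx]) (by rwa [hext, e₀.right_inv hx]) (hev hx hRX)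
          (hev hx hRY)
        rwa [hext, e₀.right_inv hx] at h)
  -- `Θ` maps straight coordinates to those of `e₀`, so its inverse is the one to compose with.
  let e := e₀.trans Θ.symm
  have hsrc {q} (hq : q ∈ e.source) : q ∈ e₀.source ∧ e₀ q ∈ Θ.target := by
    simpa [e] using hq
  have hpe : p ∈ e.source := by
    have h1 := Θ.map_source h0
    rw [hΘ0] at h1
    simpa [e] using ⟨hp, h1⟩
  have hesm : ContMDiffOn 𝓘(ℝ, E) 𝓘(ℝ, E) ∞ e e.source :=
    hΘsymm.contMDiffOn.comp (hsm.mono fun q hq ↦ (hsrc hq).1) fun q hq ↦ (hsrc hq).2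
  have hesm' : ContMDiffOn 𝓘(ℝ, E) 𝓘(ℝ, E) ∞ e.symm e.target := by
    refine hsm'.comp (t := e₀.target) (hΘ.contMDiffOn.mono fun c hc ↦ ?_) fun c hc ↦ ?_
    · exact (show c ∈ Θ.source ∧ _ by simpa [e] using hc).1
    · exact (show _ ∧ Θ c ∈ e₀.target by simpa [e] using hc).2
  refine ⟨e, R (e₀ p), hpe, e.mem_maximalAtlas_of_contMDiffOn hesm hesm',
    fun v ↦ hidem' (hmem (e₀.map_source hp)) v,
    (finrank_range_endInFrame (hmem (e₀.map_source hp))).trans (hrank _), fun q hq v ↦ ?_⟩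
  have hc : e q ∈ Θ.source := Θ.map_target (hsrc hq).2
  have hΘe {q} (hq : q ∈ e.source) : Θ (e q) = e₀ q := Θ.right_inv (hsrc hq).2
  have hde : mvfderiv 𝓘(ℝ, E) e₀ q v = fderiv ℝ Θ (e q) (mvfderiv 𝓘(ℝ, E) e q v) := by
    rw [← mvfderiv_comp_apply' ((hΘ.contDiffAt (Θ.open_source.mem_nhds hc)).differentiableAt
      (by simp)) ((hesm.contMDiffAt (e.open_source.mem_nhds hq)).mdifferentiableAt (by simp))]
    have h1 : ⇑e₀ =ᶠ[𝓝 q] Θ ∘ e := by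
      filter_upwards [e.open_source.mem_nhds hq] with q' hq' using (hΘe hq').symm
    rw [h1.mvfderiv_eq]
  have h1 := hΘR (e q) hc (mvfderiv 𝓘(ℝ, E) e q v)
  have h2 : R (e₀ q) = endInFrame Q p q := by simp only [R, e₀.left_inv (hsrc hq).1]
  have h3 : mvfderiv 𝓘(ℝ, E) e₀ q v = tangentCoframe 𝓘(ℝ, E) p q v :=
    (tangentCoframe_eq_mvfderiv (hsrc hq).1 v).symm
  rw [← hde, hΘe hq, h2, h3, endInFrame_coframe_eq_iff (hsrc hq).1] at h1
  exact h1.symm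

end

/-! ### Foliated atlases -/

/-- A linear automorphism that takes the range of a projection of rank `k` to the space of the first
`k` coordinates. -/
lemma exists_continuousLinearEquiv_of_projection {m k : ℕ}
    {P : EuclideanSpace ℝ (Fin m) →L[ℝ] EuclideanSpace ℝ (Fin m)} (hP : ∀ v, P (P v) = P v)
    (hk : Module.finrank ℝ (LinearMap.range P.toLinearMap) = k) :
    ∃ L : EuclideanSpace ℝ (Fin m) ≃L[ℝ] EuclideanSpace ℝ (Fin m),
      ∀ v, (∀ i : Fin m, k ≤ i → L v i = 0) ↔ P v = v := by
  have hm := LinearMap.finrank_range_add_finrank_ker P.toLinearMap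
  rw [hk, finrank_euclideanSpace_fin] at hm
  have hk' : Module.finrank ℝ (LinearMap.ker P.toLinearMap) = m - k := by omega
  let b := Module.finBasisOfFinrankEq ℝ _ hk
  let c := Module.finBasisOfFinrankEq ℝ _ hk'
  let Pr : EuclideanSpace ℝ (Fin m) →ₗ[ℝ] LinearMap.range P.toLinearMap :=
    P.toLinearMap.rangeRestrict
  let Pk : EuclideanSpace ℝ (Fin m) →ₗ[ℝ] LinearMap.ker P.toLinearMap :=
    (LinearMap.id - P.toLinearMap).codRestrict _ fun v ↦ by simp [hP]
  -- The coordinates of `Pv` fill the first `k` slots, those of `v - Pv` the remaining ones.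
  let L₀ : EuclideanSpace ℝ (Fin m) →ₗ[ℝ] EuclideanSpace ℝ (Fin m) :=
    { toFun v := WithLp.toLp 2 fun i ↦ if h : (i : ℕ) < k then b.repr (Pr v) ⟨i, h⟩
        else c.repr (Pk v) ⟨i - k, by omega⟩
      map_add' v w := by
        ext i
        by_cases h : (i : ℕ) < k <;> simp [h]
      map_smul' r v := by
        ext i
        by_cases h : (i : ℕ) < k <;> simp [h] }
  have hL₀ (v i) : L₀ v i = if h : (i : ℕ) < k then b.repr (Pr v) ⟨i, h⟩
      else c.repr (Pk v) ⟨i - k, by omega⟩ := rfl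
  have key (v) : (∀ i : Fin m, k ≤ i → L₀ v i = 0) ↔ P v = v := by
    have h1 : P v = v ↔ Pk v = 0 := by
      rw [← Subtype.coe_inj]
      change _ ↔ v - P v = 0
      rw [sub_eq_zero, eq_comm]
    rw [h1, ← c.repr.map_eq_zero_iff]
    constructor
    · intro h
      ext i
      have h2 := h ⟨i + k, by omega⟩ (by simp)
      rw [hL₀, dif_neg (by simp)] at h2
      simpa using h2
    · intro h i hi
      rw [hL₀, dif_neg (by omega), h]
      rfl
  have hinj : Function.Injective L₀ := by
    refine LinearMap.ker_eq_bot.1 (LinearMap.ker_eq_bot'.2 fun v hv ↦ ?_)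
    have h1 : P v = v := (key v).1 fun i _ ↦ by rw [hv]; rfl
    have h2 : b.repr (Pr v) = 0 := by
      ext i
      have h3 := congr($hv ⟨i, by omega⟩)
      rw [hL₀, dif_pos i.2] at h3
      exact h3
    have h3 : P v = 0 := congr(($(b.repr.map_eq_zero_iff.1 h2) : EuclideanSpace ℝ (Fin m)))
    rw [← h1, h3]
  exact ⟨(LinearEquiv.ofInjectiveEndo L₀ hinj).toContinuousLinearEquiv, key⟩

section

variable {m k : ℕ} {M : Type*} [TopologicalSpace M] [ChartedSpace (EuclideanSpace ℝ (Fin m)) M]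
  [IsManifold (𝓡 m) ∞ M]

lemma fderiv_comp_symm_apply {F : Type*} [NormedAddCommGroup F] [NormedSpace ℝ F]
    {e : OpenPartialHomeomorph M (EuclideanSpace ℝ (Fin m))}
    (he : e ∈ IsManifold.maximalAtlas (𝓡 m) ∞ M) {y : EuclideanSpace ℝ (Fin m)}
    (hy : y ∈ e.target) {f : M → F}
    (hf : MDifferentiableAt (𝓡 m) 𝓘(ℝ, F) f (e.symm y)) (w : EuclideanSpace ℝ (Fin m)) :
    fderiv ℝ (f ∘ e.symm) y w =
      mvfderiv (𝓡 m) f (e.symm y) (mfderiv (𝓡 m) (𝓡 m) e.symm y w) := by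
  have h := mfderiv_comp y hf
    ((contMDiffAt_symm_of_mem_maximalAtlas he hy).mdifferentiableAt (by simp))
  rw [mfderiv_eq_fderiv] at h
  exact congr($h w)

/-- Charts that straighten the same distribution form a foliated atlas. -/
theorem exists_foliation (hk : k ≤ m) (D : Π q : M, Submodule ℝ (TangentSpace (𝓡 m) q))
    (h : ∀ p : M, ∃ e ∈ IsManifold.maximalAtlas (𝓡 m) ∞ M, p ∈ e.source ∧
      ∀ q ∈ e.source, ∀ v : TangentSpace (𝓡 m) q,
        (∀ i : Fin m, k ≤ i → mvfderiv (𝓡 m) e q v i = 0) ↔ v ∈ D q) :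
    ∃ F : Foliation m k M, ∀ p, F.leafTangentSpace p = D p := by
  let A : Set (OpenPartialHomeomorph M (EuclideanSpace ℝ (Fin m))) :=
    {e | e ∈ IsManifold.maximalAtlas (𝓡 m) ∞ M ∧ ∀ q ∈ e.source, ∀ v : TangentSpace (𝓡 m) q,
      (∀ i : Fin m, k ≤ i → mvfderiv (𝓡 m) e q v i = 0) ↔ v ∈ D q}
  have hcover (p : M) : ∃ e ∈ A, p ∈ e.source := by
    obtain ⟨e, he, hp, hD⟩ := h p
    exact ⟨e, ⟨he, hD⟩, hp⟩
  refine ⟨⟨hk, A, fun e he ↦ he.1, hcover, fun e e' he he' p hp hp' ↦ ?_⟩, fun p ↦ ?_⟩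
  · have hopen : IsOpen (e.target ∩ e.symm ⁻¹' e'.source) :=
      e.symm.isOpen_inter_preimage e'.open_source
    have hmem : e p ∈ e.target ∩ e.symm ⁻¹' e'.source :=
      ⟨e.map_source hp, by rwa [Set.mem_preimage, e.left_inv hp]⟩
    obtain ⟨r, hr, hball⟩ := Metric.isOpen_iff.1 hopen _ hmem
    refine ⟨e.source ∩ e ⁻¹' Metric.ball (e p) r,
      Filter.inter_mem (e.open_source.mem_nhds hp)
        ((e.continuousAt hp).preimage_mem_nhds (Metric.ball_mem_nhds _ hr)),
      fun q hq ↦ ⟨hq.1, ?_⟩, fun q hq q' hq' hqq' i hi ↦ ?_⟩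
    · have h1 := (hball hq.2).2
      rwa [Set.mem_preimage, e.left_inv hq.1] at h1
    -- The segment from `e q` to `e q'` stays in the convex ball, and its direction has no
    -- transverse component for `e`, so it is tangent to `D`. As `e'` straightens the same `D`, the
    -- transverse coordinates of `e'` are constant along it.
    · let w := e q' - e q
      have hw (i : Fin m) (hi : k ≤ i) : w i = 0 := by simp [w, hqq' i hi]
      let γ (t : ℝ) : EuclideanSpace ℝ (Fin m) := e q + t • w
      have hγ {t : ℝ} (ht : t ∈ Set.Icc (0 : ℝ) 1) : γ t ∈ Metric.ball (e p) r :=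
        (convex_ball (e p) r).add_smul_sub_mem hq.2 hq'.2 ht
      have hγd (t : ℝ) : HasDerivAt γ w t := by
        have h1 := ((hasDerivAt_id t).smul_const w).const_add (e q)
        rwa [one_smul] at h1
      have hd {t : ℝ} (ht : t ∈ Set.Icc (0 : ℝ) 1) :
          HasDerivAt (fun t ↦ (e' ∘ e.symm) (γ t) i) 0 t := by
        have h1 := hball (hγ ht)
        have h2 := contMDiffAt_of_mem_maximalAtlas he.1 (e.map_target h1.1)
        have h3 := contMDiffAt_of_mem_maximalAtlas he'.1 h1.2
        have h4 := contMDiffAt_symm_of_mem_maximalAtlas he.1 h1.1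
        have h5 : DifferentiableAt ℝ (e' ∘ e.symm) (γ t) :=
          ((h3.comp (γ t) h4).mdifferentiableAt (by simp)).differentiableAt
        have h6 := fderiv_comp_symm_apply he.1 h1.1 (h2.mdifferentiableAt (by simp)) w
        have h7 : e ∘ e.symm =ᶠ[𝓝 (γ t)] id := by
          filter_upwards [e.open_target.mem_nhds h1.1] with y hy using e.right_inv hy
        rw [h7.fderiv_eq, fderiv_id] at h6
        have h8 := (he'.2 _ h1.2 _).2
          ((he.2 _ (e.map_target h1.1) _).1 fun i hi ↦ by rw [← h6]; exact hw i hi) i hi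
        rw [← fderiv_comp_symm_apply he.1 h1.1 (h3.mdifferentiableAt (by simp))] at h8
        have h9 := h5.hasFDerivAt.comp_hasDerivAt t (hγd t)
        have h10 := (EuclideanSpace.proj (𝕜 := ℝ) i).hasFDerivAt.comp_hasDerivAt t h9
        rw [← h8]
        exact h10
      have h1 := constant_of_has_deriv_right_zero
        (fun t ht ↦ (hd ht).continuousAt.continuousWithinAt)
        (fun t ht ↦ (hd (Set.Ico_subset_Icc_self ht)).hasDerivWithinAt) 1 (by simp)
      simpa [γ, w, e.left_inv hq.1, e.left_inv hq'.1] using h1.symm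
  · ext v
    constructor
    · intro hv
      obtain ⟨e, he, hp⟩ := hcover p
      exact (he.2 p hp v).1 (hv e he hp)
    · exact fun hv e he hp ↦ (he.2 p hp v).2 hv

end

namespace ParacontactMetricStructure

open VectorField

variable {n : ℕ} {M : Type*} [TopologicalSpace M] [T2Space M]
  [ChartedSpace (EuclideanSpace ℝ (Fin (2 * n + 1))) M] [IsManifold (𝓡 (2 * n + 1)) ∞ M]
  (S : ParacontactMetricStructure n M) {p : M}

/-! ### The foliation tangent to `[+1]` -/

/-- The endomorphism `½(h² + h)`; if `h² = φ²` it is a projection onto the eigenspace `[+1]`. -/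
noncomputable def hProj (p : M) :
    TangentSpace (𝓡 (2 * n + 1)) p →L[ℝ] TangentSpace (𝓡 (2 * n + 1)) p :=
  (1 / 2 : ℝ) • (S.h p ∘L S.h p + S.h p)

lemma hProj_apply (u : TangentSpace (𝓡 (2 * n + 1)) p) :
    S.hProj p u = (1 / 2 : ℝ) • (S.h p (S.h p u) + S.h p u) := rfl

lemma contMDiffAt_hProj {X : Π p : M, TangentSpace (𝓡 (2 * n + 1)) p} (hX : SmoothFieldAt X p) :
    SmoothFieldAt (fun q ↦ S.hProj q (X q)) p :=
  ((S.contMDiffAt_h (S.contMDiffAt_h hX)).add_section (S.contMDiffAt_h hX)).const_smul_section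

variable (hK : ∀ (p : M) (u : TangentSpace (𝓡 (2 * n + 1)) p),
  S.g.IsNondegeneratePlane p u (S.ξ p) → S.g.sectionalCurvature p u (S.ξ p) = 0)

include hK

lemma h_hProj (u : TangentSpace (𝓡 (2 * n + 1)) p) : S.h p (S.hProj p u) = S.hProj p u := by
  rw [S.hProj_apply, map_smul, map_add, S.h_h hK (S.h p u), S.φ_φ_h, add_comm (S.h p u)]

lemma hProj_eq_iff (u : TangentSpace (𝓡 (2 * n + 1)) p) :
    S.hProj p u = u ↔ u ∈ S.hEigenspace p 1 := by
  rw [S.mem_hEigenspace_one]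
  constructor
  · intro h
    rw [← h, S.h_hProj hK]
  · intro h
    rw [S.hProj_apply, h, h]
    module

lemma hProj_hProj (u : TangentSpace (𝓡 (2 * n + 1)) p) :
    S.hProj p (S.hProj p u) = S.hProj p u :=
  (S.hProj_eq_iff hK _).2 (S.mem_hEigenspace_one.2 (S.h_hProj hK u))

lemma range_hProj : LinearMap.range (S.hProj p).toLinearMap = S.hEigenspace p 1 := by
  ext u
  constructor
  · rintro ⟨v, rfl⟩
    exact S.mem_hEigenspace_one.2 (S.h_hProj hK v)
  · exact fun hu ↦ ⟨u, (S.hProj_eq_iff hK u).2 hu⟩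

/-- Frobenius for the projection `hProj`, whose range is `[+1]`. The straightening charts single out
the range of some projection `P`; a linear change of coordinates turns it into the span of the first
`n` coordinates, as a foliated atlas requires. -/
theorem exists_foliation_hEigenspace
    (hR : ∀ (p : M), ∀ u ∈ S.hEigenspace p 1, ∀ v ∈ S.hEigenspace p 1,
      S.g.curvatureTensor p u v (S.ξ p) = 0) :
    ∃ F : Foliation (2 * n + 1) n M, ∀ p, F.leafTangentSpace p = S.hEigenspace p 1 := by
  refine exists_foliation (by omega) _ fun p ↦ ?_
  obtain ⟨e, P, hp, he, hP, hPn, heP⟩ := exists_straightening_chart (Q := S.hProj)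
    (fun p X hX ↦ S.contMDiffAt_hProj hX) (fun q v ↦ S.hProj_hProj hK v) (n := n)
    (fun q ↦ by rw [S.range_hProj hK, S.finrank_hEigenspace_one hK])
    (fun p X Y hX hY hQX hQY ↦ (S.hProj_eq_iff hK _).2
      (S.mlieBracket_mem_hEigenspace hK (hR p) hX hY
        (hQX.mono fun q hq ↦ (S.hProj_eq_iff hK _).1 hq)
        (hQY.mono fun q hq ↦ (S.hProj_eq_iff hK _).1 hq))) p
  obtain ⟨L, hL⟩ := exists_continuousLinearEquiv_of_projection hP hPn
  let e' := e.transHomeomorph L.toHomeomorph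
  have hsm : ContMDiffOn (𝓡 (2 * n + 1)) (𝓡 (2 * n + 1)) ∞ e e.source :=
    contMDiffOn_of_mem_maximalAtlas he
  have hsm' : ContMDiffOn (𝓡 (2 * n + 1)) (𝓡 (2 * n + 1)) ∞ e.symm e.target :=
    contMDiffOn_symm_of_mem_maximalAtlas he
  refine ⟨e', e'.mem_maximalAtlas_of_contMDiffOn (L.contDiff.contMDiff.comp_contMDiffOn hsm)
    (hsm'.comp (t := e.target) L.symm.contDiff.contMDiff.contMDiffOn fun c hc ↦ hc), hp,
    fun q hq v ↦ ?_⟩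
  have h1 : mvfderiv (𝓡 (2 * n + 1)) e' q v = L (mvfderiv (𝓡 (2 * n + 1)) e q v) := by
    have h2 := mvfderiv_comp_apply' (g := L) (f := e) L.differentiableAt
      ((hsm.contMDiffAt (e.open_source.mem_nhds hq)).mdifferentiableAt (by simp)) v
    rw [L.fderiv] at h2
    exact h2
  rw [h1, hL, heP q hq, S.hProj_eq_iff hK]

end ParacontactMetricStructure

theorem theorem3p2 (n : ℕ) (M : Type*) [TopologicalSpace M] [T2Space M]
    [SecondCountableTopology M] [ChartedSpace (EuclideanSpace ℝ (Fin (2 * n + 1))) M]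
    [IsManifold (𝓡 (2 * n + 1)) ∞ M] (S : ParacontactMetricStructure n M)
    (hK : ∀ (p : M) (u : TangentSpace (𝓡 (2 * n + 1)) p),
      S.g.IsNondegeneratePlane p u (S.ξ p) → S.g.sectionalCurvature p u (S.ξ p) = 0) :
    (∀ p : M,
      Module.finrank ℝ (LinearMap.range (S.h p).toLinearMap) = 2 * n ∧
      Disjoint (S.hEigenspace p 1) (S.hEigenspace p (-1)) ∧
      S.hEigenspace p 1 ⊔ S.hEigenspace p (-1) = S.distribution p) ∧
    ((∀ (p : M), ∀ u ∈ S.hEigenspace p 1, ∀ v ∈ S.hEigenspace p 1,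
        S.g.curvatureTensor p u v (S.ξ p) = 0) →
      ∃ F : Foliation (2 * n + 1) n M, ∀ L ∈ F.leaves, ∀ p ∈ L,
        F.leafTangentSpace p ≤ S.distribution p ∧
        ∀ v ∈ F.leafTangentSpace p, S.g.leviCivita S.ξ p v = 0) := by
  refine ⟨fun p ↦ ⟨?_, S.disjoint_hEigenspace, S.sup_hEigenspace hK⟩, fun hR ↦ ?_⟩
  · rw [S.range_h hK, S.finrank_distribution]
  · obtain ⟨F, hF⟩ := S.exists_foliation_hEigenspace hK hR
    refine ⟨F, fun L _ p _ ↦ ⟨?_, fun v hv ↦ ?_⟩⟩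
    · rw [hF]
      exact S.hEigenspace_le_distribution one_ne_zero
    · rw [hF] at hv
      exact S.leviCivita_ξ_of_mem hv
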